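/- Theorem 2. Let $T>0$ and $0<a_0\le a_1$. There is a constant $C_T$, depending only on $T,a_0,a_1$, such that the following holds. Let $(\mathcal V,\mathcal E)$ be a finite directed connected graph without loops, $\mathcal E\subset\mathcal V\times\mathcal V$, whose edges $e$ are identified with intervals $[0,\ell^e]$, $\ell^e>0$. For $e=(v,w)$ let $n^e(v)=-1$, $n^e(w)=1$, and $n^e=0$ at all other vertices. Let $\mathcal E(v)$ be the set of edges having $v$ as a vertex, $\mathcal V_0=\{v:|\mathcal E(v)|\ge 2\}$ and $\mathcal V_\partial=\mathcal V\setminus\mathcal V_0$. Put $L^2(\mathcal E)=\prod_e L^2(0,\ell^e)$ with the norm $\|u\|^2=\sum_e\|u^e\|^2_{L^2(0,\ell^e)}$, and $H^1_{pw}(\mathcal E)=\{u\in L^2(\mathcal E): u^e\in H^1(0,\ell^e)\ \forall e\}$. Let $a\in H^1_{pw}(\mathcal E)$ with $a_0\le a\le a_1$, and let $b^e\in\mathbb R$ be constant on every edge, with $\sum_{e\in\mathcal E(v)}b^en^e(v)=0$ for all $v\in\mathcal V_0$. Let $\mathcal E^{in}(v)$ and $\mathcal E^{out}(v)$ be the sets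 of edges with $b^en^e(v)>0$ and $b^en^e(v)<0$, respectively, and let $\mathcal V_\partial^{in}$ and $\mathcal V_\partial^{out}$ be the sets of $v\in\mathcal V_\partial$ whose edge $e$ satisfies $b^en^e(v)<0$ and $b^en^e(v)>0$, respectively. Exact solution. Let $u\in C^1([0,T];L^2(\mathcal E))\cap C^0([0,T];H^1_{pw}(\mathcal E))$ and $\hat u\in C^0([0,T];\mathbb R^{\mathcal V})$ satisfy $a^e\partial_tu^e+\partial_x(b^eu^e)=0$ on every edge for $0<t\le T$, $u(0)=u_0$, $u^e(v,t)=\hat u^v(t)$ for all $v\in\mathcal V$, $e\in\mathcal E^{out}(v)$, $\hat u^v(t)=g^v(t)$ for $v\in\mathcal V^{in}_\partial$, and $\sum_{e\in\mathcal E^{in}(v)}b^en^e(v)\hat u^v(t)=\sum_{e\in\mathcal E^{in}(v)}b^en^e(v)u^e(v,t)$ for $v\in\mathcal V_0\cup\mathcal V_\partial^{out}$. Discrete solution. Let $\mathcal T_h$ be a mesh, i.e. every edge is divided into intervals $T_i^e=[x^e_{i-1},x^e_i]$ with $0=x_0^e<\dots<x^e_{M^e}=\ell^e$, let $h$ be the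 maximal length of these intervals, and let $k\ge 0$ be an integer. Let $W_h$ be the space of functions which are polynomials of degree $\le k$ on every $T\in\mathcal T_h$ (possibly with several values at grid points), $\hat W_h$ the space of real functions on the set of grid points (grid points belonging to the same vertex being identified), and $\hat W_h^0$ the subspace of those which vanish on $\mathcal V_\partial^{in}$. Let $n=-1$ at the left and $n=1$ at the right end point of each $T$, $bn\,u_h^*=\max(bn,0)u_h+\min(bn,0)\hat u_h$, and $$b_h(u_h,\hat u_h;w_h,\hat w_h)=\sum_{T\in\mathcal T_h}\Big(-\int_T b\,u_h\,\partial_xw_h\,dx+\sum_{x\in\partial T}bn\,u_h^*\,(w_h-\hat w_h)\Big)+\sum_{v\in\mathcal V_\partial^{out}}b^en^e(v)\,\hat u_h^v\hat w_h^v ,$$ where $e$ is the edge at $v$ in the last sum. Let $u_h\in H^1([0,T];W_h)$ and $\hat u_h\in H^1([0,T];\hat W_h)$ satisfy $(u_h(0),w_h)_{L^2(\mathcal E)}=(u_0,w_h)_{L^2(\mathcal E)}$ for all $w_h\in W_h$, $\hat u_h^v(t)=g^v(t)$ for all $v\in\mathcal V^{in}_\partial$ and $t\in[0,T]$, and, for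 almost every $t\in[0,T]$, $$(a\,\partial_tu_h(t),w_h)_{L^2(\mathcal E)}+b_h(u_h(t),\hat u_h(t);w_h,\hat w_h)=0\qquad\text{for all } w_h\in W_h,\ \hat w_h\in\hat W_h^0 .$$ Claim. If, moreover, $u\in W^{1,\infty}([0,T];H^{k+1}_{pw}(\mathcal T_h))$, where $H^{s}_{pw}(\mathcal T_h)=\{w\in L^2(\mathcal E):w|_T\in H^{s}(T)\ \forall T\in\mathcal T_h\}$, then $$\|u-u_h\|_{L^\infty([0,T];L^2(\mathcal E))}\le C_T\,h^{k+1}\,|u|_{W^{1,\infty}([0,T];H^{k+1}_{pw}(\mathcal T_h))},$$ where $|w|_{H^{s}_{pw}(\mathcal T_h)}^2=\sum_{T\in\mathcal T_h}\|\partial_x^{s}w\|^2_{L^2(T)}$ and $|u|_{W^{1,\infty}([0,T];H^{s}_{pw}(\mathcal T_h))}$ is the maximum of $\operatorname{ess\,sup}_{t}|u(t)|_{H^{s}_{pw}(\mathcal T_h)}$ and $\operatorname{ess\,sup}_{t}|\partial_tu(t)|_{H^{s}_{pw}(\mathcal T_h)}$ over $t\in[0,T]$. -/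

import Mathlib

open MeasureTheory Set
open scoped ENNReal ContDiff

universe u

namespace HDG

/-! ### Sobolev spaces on an interval -/

/-- `g` is the `n`-th weak derivative of `f` on the open interval `(α, β)`. -/
def HasWeakDeriv (n : ℕ) (α β : ℝ) (f g : ℝ → ℝ) : Prop :=
  ∀ φ : ℝ → ℝ, ContDiff ℝ ∞ φ → HasCompactSupport φ → tsupport φ ⊆ Ioo α β →
    ∫ x in Ioo α β, f x * iteratedDeriv n φ x = (-1) ^ n * ∫ x in Ioo α β, g x * φ x

/-- `f` belongs to `H^n(α, β)`: it is in `L²` and has weak derivatives up to order `n` in `L²`. -/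
def MemH (n : ℕ) (α β : ℝ) (f : ℝ → ℝ) : Prop :=
  MemLp f 2 (volume.restrict (Ioo α β)) ∧
    ∀ j ≤ n, ∃ g : ℝ → ℝ, MemLp g 2 (volume.restrict (Ioo α β)) ∧ HasWeakDeriv j α β f g

/-- `f` is (the continuous representative of) a function in `H¹(0, T)`, and `f' ∈ L²(0, T)` is its
weak derivative. -/
def IsH1Deriv (T : ℝ) (f f' : ℝ → ℝ) : Prop :=
  ContinuousOn f (Icc 0 T) ∧ MemLp f 2 (volume.restrict (Ioo 0 T)) ∧
    MemLp f' 2 (volume.restrict (Ioo 0 T)) ∧ HasWeakDeriv 1 0 T f f'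

/-! ### Networks -/

/-- A metric network: a finite directed connected graph (without loops, so that every edge has
distinct start and end points) whose edges `e` carry positive lengths `ℓ e`. -/
structure Network (V : Type u) where
  /-- the directed edges `(start, end)` -/
  edges : Finset (V × V)
  /-- start and end point of an edge are different -/
  loopless : ∀ e ∈ edges, e.1 ≠ e.2
  /-- the underlying undirected graph is connected -/
  connected : (SimpleGraph.fromRel fun v w : V => (v, w) ∈ edges).Connected
  /-- the edge lengths -/
  len : {e : V × V // e ∈ edges} → ℝ
  /-- the lengths are positive -/
  len_pos : ∀ e, 0 < len e

namespace Network

variable {V : Type u} (N : Network V)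

/-- The type of edges. -/
abbrev E : Type u := {e : V × V // e ∈ N.edges}

/-- Lebesgue measure on the edge `e`, identified with the interval `(0, ℓ e)`. -/
noncomputable abbrev vol (e : N.E) : Measure ℝ := volume.restrict (Ioo 0 (N.len e))

/-- The Hilbert space `L²` of the network: the product of the `L²(0, ℓ e)` with the norm
`‖u‖² = ∑ e, ‖u e‖²`. -/
abbrev L2 : Type u := PiLp 2 fun e : N.E => Lp ℝ 2 (N.vol e)

/-- `g` is the edgewise first weak derivative of `f`; its existence says that `f` is in the
broken space `H¹_pw` of the network. -/
def IsEdgeDeriv (f g : N.L2) : Prop :=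
  ∀ e, HasWeakDeriv 1 0 (N.len e) (f e) (g e)

/-- `F` is the representative of `f` which is continuous along every (closed) edge. -/
def IsContRep (f : N.L2) (F : N.E → ℝ → ℝ) : Prop :=
  ∀ e, ContinuousOn (F e) (Icc 0 (N.len e)) ∧ f e =ᵐ[N.vol e] F e

variable [DecidableEq V]

/-- The incidence numbers `n^e(v)`: `-1` at the start, `1` at the end of `e`, and `0` elsewhere. -/
def n (e : N.E) (v : V) : ℝ :=
  if e.1.1 = v then -1 else if e.1.2 = v then 1 else 0

/-- The edges having `v` as a vertex. -/
def edgesAt (v : V) : Finset N.E :=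
  Finset.univ.filter fun e => e.1.1 = v ∨ e.1.2 = v

/-- Inner vertices (junctions). -/
def IsInner (v : V) : Prop := 2 ≤ (N.edgesAt v).card

/-- Boundary vertices with flow directed into the network. -/
def IsInflow (b : N.E → ℝ) (v : V) : Prop :=
  ¬ N.IsInner v ∧ ∃ e ∈ N.edgesAt v, b e * N.n e v < 0

/-- Boundary vertices with flow directed out of the network. -/
def IsOutflow (b : N.E → ℝ) (v : V) : Prop :=
  ¬ N.IsInner v ∧ ∃ e ∈ N.edgesAt v, 0 < b e * N.n e v

/-- The edges producing flow into the vertex `v`. -/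
noncomputable def inEdges (b : N.E → ℝ) (v : V) : Finset N.E :=
  Finset.univ.filter fun e => 0 < b e * N.n e v

/-- The edges producing flow out of the vertex `v`. -/
noncomputable def outEdges (b : N.E → ℝ) (v : V) : Finset N.E :=
  Finset.univ.filter fun e => b e * N.n e v < 0

/-- Conservation of the flow rates `b` at the junctions. -/
def FlowConservation (b : N.E → ℝ) : Prop :=
  ∀ v, N.IsInner v → ∑ e ∈ N.edgesAt v, b e * N.n e v = 0

/-- The coordinate on `[0, ℓ e]` of an end point `v` of the edge `e`. -/
def coord (e : N.E) (v : V) : ℝ :=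
  if e.1.1 = v then 0 else N.len e

/-- The time derivative in `L²` on `[0, T]` (one-sided at the end points). -/
noncomputable def timeDeriv {V : Type u} (N : Network V) (T : ℝ) (w : ℝ → N.L2) : ℝ → N.L2 :=
  fun t => derivWithin w (Icc 0 T) t

/-- `(u, û)` is a solution on `[0, T]` of the transport problem with cross sections `a`, flow rates
`b`, initial value `u₀` and inflow data `g`, in the class
`u ∈ C¹([0,T]; L²) ∩ C⁰([0,T]; H¹_pw)`, `û ∈ C⁰([0,T])`. -/
structure IsSolution (T : ℝ) (a : N.E → ℝ → ℝ) (b : N.E → ℝ) (u₀ : N.L2) (g : V → ℝ → ℝ)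
    (u : ℝ → N.L2) (uhat : ℝ → V → ℝ) : Prop where
  /-- `u ∈ C¹([0,T]; L²)` -/
  contDiffOn : ContDiffOn ℝ 1 u (Icc 0 T)
  /-- `û ∈ C⁰([0,T])` -/
  hat_continuousOn : ∀ v, ContinuousOn (fun t => uhat t v) (Icc 0 T)
  /-- `u ∈ C⁰([0,T]; H¹_pw)`, and `a ∂ₜu + b ∂ₓu = 0` almost everywhere on every edge -/
  transport : ∃ ux : ℝ → N.L2, ContinuousOn ux (Icc 0 T) ∧
    (∀ t ∈ Icc 0 T, N.IsEdgeDeriv (u t) (ux t)) ∧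
    ∀ t ∈ Ioc 0 T, ∀ e, ∀ᵐ x ∂(N.vol e), a e x * N.timeDeriv T u t e x + b e * ux t e x = 0
  /-- the initial condition -/
  initial : u 0 = u₀
  /-- the boundary values at inflow vertices -/
  inflow : ∀ t ∈ Icc 0 T, ∀ v, N.IsInflow b v → uhat t v = g v t
  /-- the coupling conditions: the value at the start of the outgoing edges, and the mixing rule -/
  coupling : ∀ t ∈ Icc 0 T, ∃ F : N.E → ℝ → ℝ, N.IsContRep (u t) F ∧
    (∀ v, ∀ e ∈ N.outEdges b v, F e (N.coord e v) = uhat t v) ∧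
    ∀ v, N.IsInner v ∨ N.IsOutflow b v →
      ∑ e ∈ N.inEdges b v, b e * N.n e v * uhat t v =
        ∑ e ∈ N.inEdges b v, b e * N.n e v * F e (N.coord e v)

end Network

/-! ### Meshes -/

/-- A mesh: every edge `e` is divided by grid points `0 = x₀ < x₁ < ⋯ < x_M = ℓ e`. -/
structure Mesh {V : Type u} (N : Network V) where
  /-- the number `M` of elements on each edge -/
  num : N.E → ℕ
  /-- the grid points on each edge -/
  pt : (e : N.E) → Fin (num e + 1) → ℝ
  /-- the grid points are increasing -/
  strictMono : ∀ e, StrictMono (pt e)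
  /-- the first grid point is `0` -/
  pt_zero : ∀ e, pt e 0 = 0
  /-- the last grid point is `ℓ e` -/
  pt_last : ∀ e, pt e (Fin.last (num e)) = N.len e

namespace Mesh

variable {V : Type u} {N : Network V} (M : Mesh N)

/-- The elements of the mesh. -/
abbrev Elem : Type u := (e : N.E) × Fin (M.num e)

/-- Left end point of an element. -/
def left (τ : M.Elem) : ℝ := M.pt τ.1 τ.2.castSucc

/-- Right end point of an element. -/
def right (τ : M.Elem) : ℝ := M.pt τ.1 τ.2.succ

/-- The global mesh size, i.e. the maximal length of an element. -/
noncomputable def h : ℝ := ⨆ τ : M.Elem, (M.right τ - M.left τ)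

/-- `g` is the elementwise `j`-th weak derivative of `f`. -/
def IsBrokenDeriv (j : ℕ) (f g : N.L2) : Prop :=
  ∀ τ : M.Elem, HasWeakDeriv j (M.left τ) (M.right τ) (f τ.1) (g τ.1)

/-- The seminorm `|f| = ‖∂ₓⁿ f‖` (with the elementwise `n`-th weak derivative) of the broken space
`Hⁿ_pw` over the mesh; it is `∞` if `f` has no such derivative in `L²`. -/
noncomputable def brokenSeminorm (n : ℕ) (f : N.L2) : ℝ≥0∞ :=
  ⨅ g : {g : N.L2 // M.IsBrokenDeriv n f g}, ‖g.1‖ₑ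

/-- `w ∈ L^∞(0, T; Hⁿ_pw)`: all elementwise weak derivatives up to order `n` exist at almost every
time, and are (strongly measurable and) essentially bounded with values in `L²`. -/
def MemLinfH (n : ℕ) (T : ℝ) (w : ℝ → N.L2) : Prop :=
  ∀ j ≤ n, ∃ D : ℝ → N.L2, MemLp D ∞ (volume.restrict (Icc 0 T)) ∧
    ∀ᵐ t ∂(volume.restrict (Icc 0 T)), M.IsBrokenDeriv j (w t) (D t)

/-- `w ∈ W^{1,∞}(0, T; Hⁿ_pw)`, for functions `w` in `C¹([0, T]; L²)`. -/
def MemW1infH (n : ℕ) (T : ℝ) (w : ℝ → N.L2) : Prop :=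
  M.MemLinfH n T w ∧ M.MemLinfH n T (N.timeDeriv T w)

/-- The seminorm `|w|` of `W^{1,∞}(0, T; Hⁿ_pw)`: the maximum of the essential suprema over `(0, T)`
of the broken seminorms of `w` and of `∂ₜw`. -/
noncomputable def w1infSeminorm (n : ℕ) (T : ℝ) (w : ℝ → N.L2) : ℝ≥0∞ :=
  max (essSup (fun t => M.brokenSeminorm n (w t)) (volume.restrict (Icc 0 T)))
    (essSup (fun t => M.brokenSeminorm n (N.timeDeriv T w t)) (volume.restrict (Icc 0 T)))

/-- The discrete space `W_h`: a polynomial of degree at most `k` on every element. -/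
abbrev W (k : ℕ) : Type u := M.Elem → Polynomial.degreeLE ℝ (k : WithBot ℕ)

/-- The function on the edges of the network given by an element of `W_h` (grid points, a null set,
are given the value zero). -/
noncomputable def toFun {k : ℕ} (w : M.W k) (e : N.E) (x : ℝ) : ℝ :=
  ∑ i : Fin (M.num e), (Ioo (M.left ⟨e, i⟩) (M.right ⟨e, i⟩)).indicator
    (fun y => (w ⟨e, i⟩ : Polynomial ℝ).eval y) x

theorem memLp_toFun {k : ℕ} (w : M.W k) (e : N.E) : MemLp (M.toFun w e) 2 (N.vol e) := by
  unfold toFun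
  refine memLp_finsetSum _ fun i _ => MemLp.indicator measurableSet_Ioo ?_
  have hc : Continuous fun y => (w ⟨e, i⟩ : Polynomial ℝ).eval y := Polynomial.continuous _
  obtain ⟨B, hB⟩ := isCompact_Icc.exists_bound_of_continuousOn (s := Icc 0 (N.len e))
    hc.continuousOn
  refine MemLp.of_bound hc.aestronglyMeasurable B ?_
  filter_upwards [ae_restrict_mem measurableSet_Ioo] with x hx
  exact hB x (Ioo_subset_Icc_self hx)

/-- The inclusion of `W_h` into `L²` of the network. -/
noncomputable def toL2 {k : ℕ} (w : M.W k) : N.L2 :=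
  WithLp.toLp 2 fun e => (M.memLp_toFun w e).toLp (M.toFun w e)

/-- The grid points: the vertices of the network and the grid points in the interior of edges. Grid
points which belong to the same vertex are identified. -/
abbrev GridPt : Type u :=
  V ⊕ {p : (e : N.E) × Fin (M.num e + 1) // p.2 ≠ 0 ∧ p.2 ≠ Fin.last (M.num p.1)}

/-- The grid point with the number `j` on the edge `e`. -/
def node (e : N.E) (j : Fin (M.num e + 1)) : M.GridPt :=
  if h0 : j = 0 then Sum.inl e.1.1
  else if h1 : j = Fin.last (M.num e) then Sum.inl e.1.2
  else Sum.inr ⟨⟨e, j⟩, h0, h1⟩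

/-- The grid point at the left end of an element. -/
def nodeL (τ : M.Elem) : M.GridPt := M.node τ.1 τ.2.castSucc

/-- The grid point at the right end of an element. -/
def nodeR (τ : M.Elem) : M.GridPt := M.node τ.1 τ.2.succ

/-- The upwind flux `bn u* = max(bn, 0) u + min(bn, 0) û`. -/
def upwind (bn u uhat : ℝ) : ℝ := max bn 0 * u + min bn 0 * uhat

open Classical in
/-- The bilinear form
`b_h(u, û; w, ŵ) = -(b u, ∂ₓw) + ⟨bn u*, w - ŵ⟩ + ⟨bn û, ŵ⟩`, the second term being the sum over the
end points of all elements (with outer normal `n = -1` at the left and `n = 1` at the right end), the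
last one the sum over the outflow vertices. -/
noncomputable def bilin [Fintype V] [DecidableEq V] {k : ℕ} (b : N.E → ℝ)
    (u : M.W k) (uhat : M.GridPt → ℝ) (w : M.W k) (what : M.GridPt → ℝ) : ℝ :=
  -(∑ τ : M.Elem, ∫ x in M.left τ..M.right τ,
      b τ.1 * (u τ : Polynomial ℝ).eval x * (w τ : Polynomial ℝ).derivative.eval x)
  + ∑ τ : M.Elem,
      (upwind (-b τ.1) ((u τ : Polynomial ℝ).eval (M.left τ)) (uhat (M.nodeL τ))
          * ((w τ : Polynomial ℝ).eval (M.left τ) - what (M.nodeL τ))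
        + upwind (b τ.1) ((u τ : Polynomial ℝ).eval (M.right τ)) (uhat (M.nodeR τ))
          * ((w τ : Polynomial ℝ).eval (M.right τ) - what (M.nodeR τ)))
  + ∑ v : V with N.IsOutflow b v, ∑ e ∈ N.edgesAt v,
      b e * N.n e v * uhat (Sum.inl v) * what (Sum.inl v)

/-- `(u_h, û_h)` is a solution of the semi-discrete hybrid discontinuous Galerkin scheme on `[0, T]`,
with `u_h ∈ H¹([0,T]; W_h)` and `û_h ∈ H¹([0,T]; Ŵ_h)`. -/
structure IsHDGSolution [Fintype V] [DecidableEq V] {k : ℕ} (T : ℝ) (a : N.E → ℝ → ℝ)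
    (b : N.E → ℝ) (u₀ : N.L2) (g : V → ℝ → ℝ) (uh : ℝ → M.W k) (uhhat : ℝ → M.GridPt → ℝ) :
    Prop where
  /-- `û_h ∈ H¹([0,T]; Ŵ_h)` -/
  hat_mem : ∀ p, ∃ q : ℝ → ℝ, IsH1Deriv T (fun t => uhhat t p) q
  /-- the initial value is the `L²` projection of `u₀` -/
  initial : ∀ w : M.W k,
    ∑ τ : M.Elem, ∫ x in M.left τ..M.right τ,
        (uh 0 τ : Polynomial ℝ).eval x * (w τ : Polynomial ℝ).eval x =
      ∑ τ : M.Elem, ∫ x in M.left τ..M.right τ, u₀ τ.1 x * (w τ : Polynomial ℝ).eval x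
  /-- the boundary values at inflow vertices -/
  inflow : ∀ t ∈ Icc 0 T, ∀ v, N.IsInflow b v → uhhat t (Sum.inl v) = g v t
  /-- `u_h ∈ H¹([0,T]; W_h)` (coefficientwise), and the variational equation -/
  equation : ∃ uh' : ℝ → M.W k,
    (∀ (τ : M.Elem) (m : ℕ), IsH1Deriv T (fun t => (uh t τ : Polynomial ℝ).coeff m)
      (fun t => (uh' t τ : Polynomial ℝ).coeff m)) ∧
    ∀ᵐ t ∂(volume.restrict (Icc 0 T)), ∀ (w : M.W k) (what : M.GridPt → ℝ),
      (∀ v, N.IsInflow b v → what (Sum.inl v) = 0) →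
      (∑ τ : M.Elem, ∫ x in M.left τ..M.right τ,
          a τ.1 x * (uh' t τ : Polynomial ℝ).eval x * (w τ : Polynomial ℝ).eval x)
        + M.bilin b (uh t) (uhhat t) w what = 0

end Mesh

end HDG

/-! The error `u - uh` is split into the projection error `η = u - p` and the discrete error
`e = p - uh`, where `p(t)` is the elementwise Radau projection of `u(t)`: it interpolates `u(t)` at the
end point where the flow leaves the element and has the same moments of order less than `k`. The
hybrid variable is compared with the nodal values of `u`.

*Consistency.* With this projection the upwind fluxes are the exact ones and the volume terms do not
see `η`, so that the bilinear form evaluated at `p` and the nodal values is `(b ∂ₓu, w)`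
(`Mesh.bilin_radau`). *Stability.* The bilinear form is nonnegative on the diagonal
(`Mesh.bilin_self_nonneg`), by upwinding, flow conservation at the junctions and the outflow term.
Together, the error equation tested with `e` reads `(a ∂ₜ(u - uh), e) ≤ 0`
(`Mesh.aForm_error_nonpos`), that is, `½ d/dt (a e, e) ≤ -(a ∂ₜη, e)`, and Gronwall's lemma bounds `e`
by its initial value and by `∂ₜη` (`Mesh.energy_estimate`). The initial value of `uh` is the `L²`
projection of `u(0)`, so `e(0)` is bounded by `η(0)`.

*Approximation.* The derivative of the Radau projection is the best approximation of the derivative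
in a weighted `L²` space. Hardy's inequality (`radau_error_le`) and Taylor approximation
(`exists_polynomial_approx`) therefore give `‖η‖ ≤ 2 h^(k+1) |u|` with a constant independent of `k`.

*Time regularity.* It is never necessary to differentiate the projection in time: the estimate is
applied to the increments `u(t) - u(s)`, whose broken derivatives are Bochner integrals of those of
`∂ₜu`. Hence `η` is Lipschitz in time with constant `2 h^(k+1) |u|`
(`Mesh.norm_projection_error_sub_le`), and so the coefficients of `p` are absolutely continuous and
differentiable almost everywhere.

Both in space and in time, functions with weak derivatives are handled through their absolutely
continuous representatives, which exist by the lemma of du Bois-Reymond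
(`HasWeakDeriv.exists_hasACDeriv`). -/

namespace HDG

/-! ### Absolutely continuous functions and weak derivatives on an interval -/

/-- `F` is absolutely continuous on `[α, β]`, with pointwise derivative `g` at almost every point.
This is the working form of "`F` belongs to `W^{1,1}(α, β)` and `F' = g`", used both in space and in
time. -/
def HasACDeriv (α β : ℝ) (F g : ℝ → ℝ) : Prop :=
  AbsolutelyContinuousOnInterval F α β ∧ ∀ᵐ x, x ∈ Ioo α β → HasDerivAt F (g x) x

namespace HasACDeriv

variable {α β : ℝ} {F G f g : ℝ → ℝ}

theorem add (hF : HasACDeriv α β F f) (hG : HasACDeriv α β G g) :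
    HasACDeriv α β (fun x => F x + G x) (fun x => f x + g x) := by
  refine ⟨hF.1.fun_add hG.1, ?_⟩
  filter_upwards [hF.2, hG.2] with x h1 h2 hx using (h1 hx).add (h2 hx)

theorem sub (hF : HasACDeriv α β F f) (hG : HasACDeriv α β G g) :
    HasACDeriv α β (fun x => F x - G x) (fun x => f x - g x) := by
  refine ⟨hF.1.fun_sub hG.1, ?_⟩
  filter_upwards [hF.2, hG.2] with x h1 h2 hx using (h1 hx).sub (h2 hx)

theorem mul (hF : HasACDeriv α β F f) (hG : HasACDeriv α β G g) :
    HasACDeriv α β (fun x => F x * G x) (fun x => f x * G x + F x * g x) := by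
  refine ⟨hF.1.fun_mul hG.1, ?_⟩
  filter_upwards [hF.2, hG.2] with x h1 h2 hx using (h1 hx).mul (h2 hx)

theorem mono (hF : HasACDeriv α β F f) {α' β' : ℝ} (h1 : α ≤ α') (h2 : α' ≤ β') (h3 : β' ≤ β) :
    HasACDeriv α' β' F f := by
  refine ⟨hF.1.mono ?_, ?_⟩
  · rw [uIcc_of_le h2, uIcc_of_le (h1.trans (h2.trans h3))]
    exact Icc_subset_Icc h1 h3
  · filter_upwards [hF.2] with x hx hx'
    exact hx (Ioo_subset_Ioo h1 h3 hx')

theorem of_contDiff (hF : ContDiff ℝ 1 F) : HasACDeriv α β F (deriv F) :=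
  ⟨hF.contDiffOn.absolutelyContinuousOnInterval,
    .of_forall fun x _ => (hF.differentiable (by simp) x).hasDerivAt⟩

theorem polynomial (p : Polynomial ℝ) :
    HasACDeriv α β (fun x => p.eval x) (fun x => p.derivative.eval x) :=
  ⟨((by simpa using p.contDiff_aeval (𝕜 := ℝ) (n := 1) :
      ContDiff ℝ 1 fun x => p.eval x).contDiffOn).absolutelyContinuousOnInterval,
    .of_forall fun x _ => p.hasDerivAt x⟩

theorem const (c : ℝ) : HasACDeriv α β (fun _ => c) (fun _ => 0) := by
  simpa using polynomial (α := α) (β := β) (Polynomial.C c)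

theorem const_mul (c : ℝ) (hF : HasACDeriv α β F f) :
    HasACDeriv α β (fun x => c * F x) (fun x => c * f x) := by
  simpa using (const c).mul hF

theorem sum {ι : Type*} (s : Finset ι) {F f : ι → ℝ → ℝ}
    (h : ∀ i ∈ s, HasACDeriv α β (F i) (f i)) :
    HasACDeriv α β (fun x => ∑ i ∈ s, F i x) (fun x => ∑ i ∈ s, f i x) := by
  classical
  induction s using Finset.induction_on with
  | empty => simpa using const (α := α) (β := β) 0
  | insert i s hi ih =>
    simp only [Finset.sum_insert hi]
    exact (h i (Finset.mem_insert_self i s)).add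
      (ih fun j hj => h j (Finset.mem_insert_of_mem hj))

theorem congr (hαβ : α ≤ β) (hF : HasACDeriv α β F f) (h : EqOn F G (Icc α β)) :
    HasACDeriv α β G f := by
  refine ⟨?_, ?_⟩
  · have h1 := hF.1
    rw [absolutelyContinuousOnInterval_iff] at h1 ⊢
    intro ε hε
    obtain ⟨δ, hδ, H⟩ := h1 ε hε
    refine ⟨δ, hδ, fun E hE hd => ?_⟩
    have h2 := H E hE hd
    have h3 := hE.1
    rw [uIcc_of_le hαβ] at h3
    rwa [Finset.sum_congr rfl fun i hi => by rw [← h (h3 i hi).1, ← h (h3 i hi).2]]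
  · filter_upwards [hF.2] with x hx hx'
    exact (hx hx').congr_of_eventuallyEq
      ((h.mono Ioo_subset_Icc_self).symm.eventuallyEq_of_mem (isOpen_Ioo.mem_nhds hx'))

theorem ae_deriv (hF : HasACDeriv α β F f) (hαβ : α ≤ β) :
    ∀ᵐ x, x ∈ uIoc α β → deriv F x = f x := by
  rw [uIoc_of_le hαβ]
  filter_upwards [hF.2, compl_mem_ae_iff.2 (measure_singleton (μ := volume) β)] with x h1 h2 h3
  exact (h1 ⟨h3.1, lt_of_le_of_ne h3.2 h2⟩).deriv

theorem intervalIntegrable (hF : HasACDeriv α β F f) (hαβ : α ≤ β) :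
    IntervalIntegrable f volume α β := by
  refine hF.1.intervalIntegrable_deriv.congr_ae ?_
  rw [Filter.EventuallyEq, ae_restrict_iff' measurableSet_uIoc]
  exact hF.ae_deriv hαβ

theorem integral_eq (hF : HasACDeriv α β F f) (hαβ : α ≤ β) :
    ∫ x in α..β, f x = F β - F α := by
  rw [← hF.1.integral_deriv_eq_sub]
  refine intervalIntegral.integral_congr_ae ?_
  filter_upwards [hF.ae_deriv hαβ] with x hx hx' using (hx hx').symm

theorem continuousOn (hF : HasACDeriv α β F f) (hαβ : α ≤ β) : ContinuousOn F (Icc α β) := by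
  have := hF.1.continuousOn
  rwa [uIcc_of_le hαβ] at this

/-- Integration by parts. -/
theorem integral_mul_add (hF : HasACDeriv α β F f) (hG : HasACDeriv α β G g) (hαβ : α ≤ β) :
    (∫ x in α..β, f x * G x) + ∫ x in α..β, F x * g x = F β * G β - F α * G α := by
  rw [← (hF.mul hG).integral_eq hαβ, intervalIntegral.integral_add]
  · exact (hF.intervalIntegrable hαβ).mul_continuousOn
      (by rw [uIcc_of_le hαβ]; exact hG.continuousOn hαβ)
  · exact (hG.intervalIntegrable hαβ).continuousOn_mul
      (by rw [uIcc_of_le hαβ]; exact hF.continuousOn hαβ)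

theorem of_integral (hαβ : α ≤ β) (hg : IntervalIntegrable g volume α β)
    (h : ∀ x ∈ Icc α β, F x = F α + ∫ y in α..x, g y) : HasACDeriv α β F g := by
  have h0 : HasACDeriv α β (fun x => ∫ y in α..x, g y) g := by
    refine ⟨hg.absolutelyContinuousOnInterval_intervalIntegral (by simp), ?_⟩
    filter_upwards [hg.ae_hasDerivAt_integral] with x hx hx'
    exact hx (by rw [uIcc_of_le hαβ]; exact Ioo_subset_Icc_self hx') α (by simp)
  have h1 := (const (α := α) (β := β) (F α)).add h0
  simp only [zero_add] at h1
  exact h1.congr hαβ fun x hx => (h x hx).symm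

end HasACDeriv

theorem integral_Ioo_eq_interval {α β : ℝ} (h : α ≤ β) (f : ℝ → ℝ) :
    ∫ x in Ioo α β, f x = ∫ x in α..β, f x := by
  rw [intervalIntegral.integral_of_le h, integral_Ioc_eq_integral_Ioo]

/-- An integrable function which is orthogonal to all test functions vanishes. -/
theorem ae_zero_of_forall_test {α β : ℝ} {f : ℝ → ℝ} (hf : IntegrableOn f (Ioo α β))
    (h : ∀ φ : ℝ → ℝ, ContDiff ℝ ∞ φ → HasCompactSupport φ → tsupport φ ⊆ Ioo α β →
      ∫ x in Ioo α β, f x * φ x = 0) :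
    f =ᵐ[volume.restrict (Ioo α β)] 0 := by
  have h1 : ∀ᵐ x ∂(volume : Measure ℝ), x ∈ Ioo α β → f x = 0 := by
    refine IsOpen.ae_eq_zero_of_integral_contDiff_smul_eq_zero isOpen_Ioo
      hf.locallyIntegrableOn fun φ h1 h2 h3 => ?_
    rw [← h φ h1 h2 h3, setIntegral_eq_integral_of_forall_compl_eq_zero]
    · simp [mul_comm]
    · intro x hx
      rw [image_eq_zero_of_notMem_tsupport fun h => hx (h3 h), mul_zero]
  exact (ae_restrict_iff' measurableSet_Ioo).2 h1

theorem integrableOn_mul_test {α β : ℝ} {f φ : ℝ → ℝ} (hf : IntegrableOn f (Ioo α β))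
    (hφ : Continuous φ) : IntegrableOn (fun x => f x * φ x) (Ioo α β) :=
  (hf.congr_set_ae Ioo_ae_eq_Icc.symm |>.mul_continuousOn hφ.continuousOn isCompact_Icc).mono_set
    Ioo_subset_Icc_self

/-- Lemma of du Bois-Reymond: a function with zero weak derivative is constant. The idea is that
every test function differs from a derivative of a test function by a multiple of a fixed bump. -/
theorem ae_const_of_weakDeriv_zero {α β : ℝ} (hαβ : α < β) {f : ℝ → ℝ}
    (hf : IntegrableOn f (Ioo α β))
    (h : ∀ φ : ℝ → ℝ, ContDiff ℝ ∞ φ → HasCompactSupport φ → tsupport φ ⊆ Ioo α β →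
      ∫ x in Ioo α β, f x * deriv φ x = 0) :
    ∃ c : ℝ, f =ᵐ[volume.restrict (Ioo α β)] fun _ => c := by
  let B : ContDiffBump ((α + β) / 2) :=
    ⟨(β - α) / 8, (β - α) / 4, by linarith, by linarith⟩
  let ψ : ℝ → ℝ := B.normed volume
  have hψ : ContDiff ℝ ∞ ψ := B.contDiff_normed
  have hψc : HasCompactSupport ψ := B.hasCompactSupport_normed
  have hψs : tsupport ψ ⊆ Ioo α β := by
    rw [B.tsupport_normed_eq, Real.closedBall_eq_Icc]
    intro x hx
    have h1 : B.rOut = (β - α) / 4 := rfl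
    rw [h1] at hx
    constructor <;> linarith [hx.1, hx.2]
  have hψi : ∫ x, ψ x = 1 := B.integral_normed
  refine ⟨∫ x in Ioo α β, f x * ψ x, ?_⟩
  set c := ∫ x in Ioo α β, f x * ψ x with hc
  have hcint : IntegrableOn (fun _ : ℝ => c) (Ioo α β) := by simp
  have key : (fun x => f x - c) =ᵐ[volume.restrict (Ioo α β)] 0 := by
    refine ae_zero_of_forall_test (hf.sub hcint) fun φ h1 h2 h3 => ?_
    set I := ∫ x, φ x with hI
    let θ : ℝ → ℝ := fun x => φ x - I * ψ x
    have hθ : ContDiff ℝ ∞ θ := h1.sub (contDiff_const.mul hψ)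
    have hθs : tsupport θ ⊆ tsupport φ ∪ tsupport ψ := by
      refine (closure_minimal ?_ ((isClosed_tsupport _).union (isClosed_tsupport _)))
      intro x hx
      by_contra hx'
      rw [mem_union, not_or] at hx'
      exact hx (by simp [θ, image_eq_zero_of_notMem_tsupport hx'.1,
        image_eq_zero_of_notMem_tsupport hx'.2])
    have hK : IsCompact (tsupport φ ∪ tsupport ψ ∪ {(α + β) / 2}) :=
      (h2.isCompact.union hψc.isCompact).union isCompact_singleton
    have hKs : tsupport φ ∪ tsupport ψ ∪ {(α + β) / 2} ⊆ Ioo α β := by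
      refine union_subset (union_subset h3 hψs) ?_
      rintro x rfl
      constructor <;> linarith
    have hKn : (tsupport φ ∪ tsupport ψ ∪ {(α + β) / 2}).Nonempty := ⟨_, Or.inr rfl⟩
    obtain ⟨p, hpK, hp⟩ := hK.exists_isLeast hKn
    obtain ⟨q, hqK, hq⟩ := hK.exists_isGreatest hKn
    have hpα := (hKs hpK).1
    have hqβ := (hKs hqK).2
    have hθ0 : ∀ x, x ∉ Icc p q → θ x = 0 := by
      intro x hx
      by_contra hne
      have h4 := Or.inl (b := x ∈ ({(α + β) / 2} : Set ℝ)) (hθs (subset_tsupport _ hne))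
      exact hx ⟨hp h4, hq h4⟩
    have hθint : ∫ x, θ x = 0 := by
      have e1 : Integrable φ := h1.continuous.integrable_of_hasCompactSupport h2
      have e2 : Integrable ψ := hψ.continuous.integrable_of_hasCompactSupport hψc
      simp only [θ]
      rw [integral_sub e1 (e2.const_mul I), integral_const_mul, hψi, ← hI, mul_one, sub_self]
    let Φ : ℝ → ℝ := fun x => ∫ y in α..x, θ y
    have hΦd : ∀ x, HasDerivAt Φ (θ x) x := fun x =>
      intervalIntegral.integral_hasDerivAt_right (hθ.continuous.intervalIntegrable _ _)
        (hθ.continuous.stronglyMeasurableAtFilter _ _) hθ.continuous.continuousAt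
    have hΦ' : deriv Φ = θ := funext fun x => (hΦd x).deriv
    have hΦ : ContDiff ℝ ∞ Φ :=
      contDiff_infty_iff_deriv.2 ⟨fun x => (hΦd x).differentiableAt, by rw [hΦ']; exact hθ⟩
    have hΦ0 : ∀ x, x ∉ Icc p q → Φ x = 0 := by
      intro x hx
      by_cases hxp : x < p
      · have : ∫ y in α..x, θ y = ∫ y in α..x, (0 : ℝ) := by
          refine intervalIntegral.integral_congr fun y hy => hθ0 y fun hy' => ?_
          have := hy.2
          rcases le_total α x with h | h <;> simp [h] at this <;> linarith [hy'.1]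
        simpa using this
      · have hxq : q < x := by
          by_contra hh
          exact hx ⟨not_lt.1 hxp, not_lt.1 hh⟩
        have : ∫ y in α..x, θ y = ∫ y, θ y := by
          refine intervalIntegral.integral_eq_integral_of_support_subset fun y hy => ?_
          by_contra hy'
          refine hy (hθ0 y fun hy'' => hy' ⟨by linarith [hy''.1], by linarith [hy''.2]⟩)
        simpa [Φ, hθint] using this
    have hΦsupp : tsupport Φ ⊆ Icc p q := by
      refine closure_minimal (fun x hx => ?_) isClosed_Icc
      by_contra hx'
      exact hx (hΦ0 x hx')
    have h5 := h Φ hΦ (HasCompactSupport.intro isCompact_Icc hΦ0)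
      (hΦsupp.trans fun x hx => ⟨by linarith [hx.1], by linarith [hx.2]⟩)
    rw [hΦ'] at h5
    have hIφ : ∫ x in Ioo α β, φ x = I := by
      refine setIntegral_eq_integral_of_forall_compl_eq_zero fun x hx => ?_
      exact image_eq_zero_of_notMem_tsupport fun h => hx (h3 h)
    have e3 : ∫ x in Ioo α β, f x * θ x = (∫ x in Ioo α β, f x * φ x) - I * c := by
      rw [hc, ← integral_const_mul, ← integral_sub (integrableOn_mul_test hf h1.continuous)
        ((integrableOn_mul_test hf hψ.continuous).const_mul I)]
      exact integral_congr_ae (.of_forall fun x => by simp only [θ]; ring)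
    have e4 : ∫ x in Ioo α β, (f x - c) * φ x = (∫ x in Ioo α β, f x * φ x) - c * I := by
      rw [← hIφ, ← integral_const_mul, ← integral_sub (integrableOn_mul_test hf h1.continuous)
        ((integrableOn_mul_test hcint h1.continuous))]
      exact integral_congr_ae (.of_forall fun x => by ring)
    rw [e4]
    linarith
  filter_upwards [key] with x hx
  simpa [sub_eq_zero] using hx

/-- A function with an integrable weak derivative has an absolutely continuous representative. -/
theorem HasWeakDeriv.exists_hasACDeriv {α β : ℝ} (hαβ : α < β) {f g : ℝ → ℝ}
    (hf : IntegrableOn f (Ioo α β)) (hg : IntegrableOn g (Ioo α β))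
    (hw : HasWeakDeriv 1 α β f g) :
    ∃ F : ℝ → ℝ, HasACDeriv α β F g ∧ f =ᵐ[volume.restrict (Ioo α β)] F := by
  have hgi : IntervalIntegrable g volume α β :=
    (intervalIntegrable_iff_integrableOn_Ioo_of_le hαβ.le).2 hg
  have hG : HasACDeriv α β (fun x => ∫ y in α..x, g y) g :=
    HasACDeriv.of_integral hαβ.le hgi fun x _ => by simp
  have hGi : IntegrableOn (fun x => ∫ y in α..x, g y) (Ioo α β) :=
    ((hG.continuousOn hαβ.le).integrableOn_compact isCompact_Icc).mono_set Ioo_subset_Icc_self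
  obtain ⟨c, hc⟩ := ae_const_of_weakDeriv_zero hαβ (f := fun x => f x - ∫ y in α..x, g y)
    (hf.sub hGi) (by
      intro φ h1 h2 h3
      have e1 := hw φ h1 h2 h3
      have hφ' : Continuous (deriv φ) := h1.continuous_deriv (by simp)
      have e2 := hG.integral_mul_add (HasACDeriv.of_contDiff (h1.of_le (by simp))) hαβ.le
      have hβ : φ β = 0 := image_eq_zero_of_notMem_tsupport fun h => lt_irrefl _ (h3 h).2
      have hα : φ α = 0 := image_eq_zero_of_notMem_tsupport fun h => lt_irrefl _ (h3 h).1
      rw [hβ, hα, mul_zero, mul_zero, sub_zero, ← integral_Ioo_eq_interval hαβ.le,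
        ← integral_Ioo_eq_interval hαβ.le] at e2
      rw [iteratedDeriv_one, pow_one, neg_one_mul] at e1
      simp only [sub_mul]
      rw [integral_sub (integrableOn_mul_test hf hφ') (integrableOn_mul_test hGi hφ')]
      linarith)
  refine ⟨fun x => c + ∫ y in α..x, g y, ?_, ?_⟩
  · simpa using (HasACDeriv.const c).add hG
  · filter_upwards [hc] with x hx
    linarith

/-- A continuous representative of a function with an integrable weak derivative is absolutely
continuous, and its derivative is the weak derivative. -/
theorem HasWeakDeriv.hasACDeriv {α β : ℝ} (hαβ : α < β) {f F g : ℝ → ℝ}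
    (hF : ContinuousOn F (Icc α β)) (hfF : f =ᵐ[volume.restrict (Ioo α β)] F)
    (hg : IntegrableOn g (Ioo α β)) (hw : HasWeakDeriv 1 α β f g) : HasACDeriv α β F g := by
  have hFi : IntegrableOn F (Ioo α β) :=
    (hF.integrableOn_compact isCompact_Icc).mono_set Ioo_subset_Icc_self
  obtain ⟨G, hG, hGf⟩ := hw.exists_hasACDeriv hαβ (hFi.congr_fun_ae hfF.symm) hg
  refine hG.congr hαβ.le (Measure.eqOn_Icc_of_ae_eq volume hαβ.ne ?_ (hG.continuousOn hαβ.le) hF)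
  rw [← restrict_Ioo_eq_restrict_Icc]
  exact hGf.symm.trans hfF

/-- Uniqueness of weak derivatives. -/
theorem HasWeakDeriv.ae_eq {n : ℕ} {α β : ℝ} {f g g' : ℝ → ℝ}
    (hg : IntegrableOn g (Ioo α β)) (hg' : IntegrableOn g' (Ioo α β))
    (h : HasWeakDeriv n α β f g) (h' : HasWeakDeriv n α β f g') :
    g =ᵐ[volume.restrict (Ioo α β)] g' := by
  have := ae_zero_of_forall_test (f := fun x => g x - g' x) (hg.sub hg') fun φ h1 h2 h3 => by
    have e := (h φ h1 h2 h3).symm.trans (h' φ h1 h2 h3)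
    have e' := mul_left_cancel₀ (pow_ne_zero n (by norm_num : (-1 : ℝ) ≠ 0)) e
    simp only [sub_mul]
    rw [integral_sub (integrableOn_mul_test hg h1.continuous)
      (integrableOn_mul_test hg' h1.continuous), e', sub_self]
  filter_upwards [this] with x hx
  simpa [sub_eq_zero] using hx

theorem IsH1Deriv.hasACDeriv {T : ℝ} (hT : 0 < T) {f f' : ℝ → ℝ} (h : IsH1Deriv T f f') :
    HasACDeriv 0 T f f' :=
  HasWeakDeriv.hasACDeriv hT h.1 Filter.EventuallyEq.rfl
    (h.2.2.1.integrable (by norm_num)) h.2.2.2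

/-- The `(j+1)`-st weak derivative is the first weak derivative of the `j`-th. -/
theorem HasWeakDeriv.succ {j : ℕ} {α β : ℝ} {f g g' : ℝ → ℝ} (h : HasWeakDeriv j α β f g)
    (h' : HasWeakDeriv (j + 1) α β f g') : HasWeakDeriv 1 α β g g' := by
  intro φ h1 h2 h3
  have e1 := h (deriv φ) (contDiff_infty_iff_deriv.1 h1).2 h2.deriv
    (tsupport_deriv_subset.trans h3)
  have e2 := h' φ h1 h2 h3
  rw [iteratedDeriv_succ', e1, pow_succ, mul_assoc] at e2
  have := mul_left_cancel₀ (pow_ne_zero j (by norm_num : (-1 : ℝ) ≠ 0)) e2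
  rw [iteratedDeriv_one, pow_one]
  exact this

/-- Weak derivatives restrict to subintervals. -/
theorem HasWeakDeriv.mono {n : ℕ} {α β α' β' : ℝ} {f g : ℝ → ℝ} (h : HasWeakDeriv n α β f g)
    (h1 : α ≤ α') (h2 : β' ≤ β) : HasWeakDeriv n α' β' f g := by
  intro φ p1 p2 p3
  have hsub : Ioo α' β' ⊆ Ioo α β := Ioo_subset_Ioo h1 h2
  have e := h φ p1 p2 (p3.trans hsub)
  have key : ∀ (s : Set ℝ), Ioo α' β' ⊆ s → ∀ (u ψ : ℝ → ℝ), tsupport ψ ⊆ Ioo α' β' →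
      ∫ x in s, u x * ψ x = ∫ x, u x * ψ x := by
    intro s hs u ψ hψ
    refine setIntegral_eq_integral_of_forall_compl_eq_zero fun x hx => ?_
    rw [image_eq_zero_of_notMem_tsupport fun h => hx (hs (hψ h)), mul_zero]
  have p4 : tsupport (iteratedDeriv n φ) ⊆ Ioo α' β' := by
    refine subset_trans ?_ p3
    clear e h p1 p2 p3
    induction n generalizing φ with
    | zero => simp
    | succ n ih =>
      rw [iteratedDeriv_succ]
      exact tsupport_deriv_subset.trans (ih φ)
  rw [key _ hsub f _ p4, key _ hsub g _ p3] at e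
  rw [key _ subset_rfl f _ p4, key _ subset_rfl g _ p3]
  exact e

/-! ### Polynomial approximation on an interval -/

/-- Square integrable functions on `(α, β)`. -/
abbrev L2On (α β : ℝ) (f : ℝ → ℝ) : Prop := MemLp f 2 (volume.restrict (Ioo α β))

section L2On

variable {α β : ℝ} {f g : ℝ → ℝ}

theorem L2On.integrableOn (hf : L2On α β f) : IntegrableOn f (Ioo α β) :=
  hf.integrable (by norm_num)

theorem L2On.intervalIntegrable_mul (hαβ : α ≤ β) (hf : L2On α β f) (hg : L2On α β g) :
    IntervalIntegrable (fun x => f x * g x) volume α β :=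
  (intervalIntegrable_iff_integrableOn_Ioo_of_le hαβ).2 (hf.integrable_mul hg)

theorem L2On.intervalIntegrable_sq (hαβ : α ≤ β) (hf : L2On α β f) :
    IntervalIntegrable (fun x => f x ^ 2) volume α β := by
  simpa only [sq] using hf.intervalIntegrable_mul hαβ hf

theorem L2On.mono (hf : L2On α β f) {α' β' : ℝ} (h1 : α ≤ α') (h2 : β' ≤ β) : L2On α' β' f :=
  MemLp.mono_measure (Measure.restrict_mono (Ioo_subset_Ioo h1 h2) le_rfl) hf

theorem L2On.of_continuousOn (hf : ContinuousOn f (Icc α β)) : L2On α β f := by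
  obtain ⟨B, hB⟩ := isCompact_Icc.exists_bound_of_continuousOn hf
  refine MemLp.of_bound ((hf.mono Ioo_subset_Icc_self).aestronglyMeasurable measurableSet_Ioo) B ?_
  filter_upwards [ae_restrict_mem measurableSet_Ioo] with x hx
  exact hB x (Ioo_subset_Icc_self hx)

theorem L2On.mul_continuousOn (hf : L2On α β f) (hg : ContinuousOn g (Icc α β)) :
    L2On α β fun x => g x * f x := by
  obtain ⟨B, hB⟩ := isCompact_Icc.exists_bound_of_continuousOn hg
  refine MemLp.of_le_mul (c := B) hf (((hg.mono Ioo_subset_Icc_self).aestronglyMeasurable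
    measurableSet_Ioo).mul hf.1) ?_
  filter_upwards [ae_restrict_mem measurableSet_Ioo] with x hx
  rw [norm_mul]
  exact mul_le_mul_of_nonneg_right (hB x (Ioo_subset_Icc_self hx)) (norm_nonneg _)

theorem L2On.polynomial (p : Polynomial ℝ) : L2On α β fun x => p.eval x :=
  L2On.of_continuousOn p.continuous.continuousOn

end L2On

theorem intervalIntegral_sq_nonneg {α β : ℝ} (hαβ : α ≤ β) (f : ℝ → ℝ) :
    0 ≤ ∫ x in α..β, f x ^ 2 :=
  intervalIntegral.integral_nonneg hαβ fun _ _ => sq_nonneg _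

theorem sq_intervalIntegral_le {α β : ℝ} (hαβ : α ≤ β) {f : ℝ → ℝ} (hf : L2On α β f) :
    (∫ x in α..β, f x) ^ 2 ≤ (β - α) * ∫ x in α..β, f x ^ 2 := by
  rcases hαβ.eq_or_lt with rfl | h
  · simp
  set I := ∫ x in α..β, f x with hI
  set Q := ∫ x in α..β, f x ^ 2 with hQ
  have hfi : IntervalIntegrable f volume α β :=
    (intervalIntegrable_iff_integrableOn_Ioo_of_le hαβ).2 hf.integrableOn
  -- the variance of `f` is nonnegative
  have h0 : 0 ≤ ∫ x in α..β, (f x - I / (β - α)) ^ 2 := intervalIntegral_sq_nonneg hαβ _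
  have h1 : ∫ x in α..β, (f x - I / (β - α)) ^ 2 =
      Q - 2 * (I / (β - α)) * I + (β - α) * (I / (β - α)) ^ 2 := by
    rw [hI, hQ, ← intervalIntegral.integral_const_mul, ← intervalIntegral.integral_sub
      (hf.intervalIntegrable_sq hαβ) (hfi.const_mul _), ← hI,
      ← smul_eq_mul (β - α), ← intervalIntegral.integral_const, ← intervalIntegral.integral_add
      ((hf.intervalIntegrable_sq hαβ).sub (hfi.const_mul _)) (by simp)]
    exact intervalIntegral.integral_congr fun x _ => by ring
  have h2 : 0 < β - α := by linarith
  rw [h1] at h0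
  have h3 : (β - α) * (Q - 2 * (I / (β - α)) * I + (β - α) * (I / (β - α)) ^ 2)
      = (β - α) * Q - I ^ 2 := by
    field_simp
    ring
  nlinarith [mul_nonneg h2.le h0]

/-- Poincaré inequality for functions vanishing at the left end point. -/
theorem HasACDeriv.integral_sq_le {α β : ℝ} (hαβ : α ≤ β) {e e' : ℝ → ℝ}
    (he : HasACDeriv α β e e') (h2 : L2On α β e') (h0 : e α = 0) :
    ∫ x in α..β, e x ^ 2 ≤ (β - α) ^ 2 * ∫ x in α..β, e' x ^ 2 := by
  have hpt : ∀ x ∈ Icc α β, e x ^ 2 ≤ (β - α) * ∫ x in α..β, e' x ^ 2 := by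
    intro x hx
    have h3 := (he.mono le_rfl hx.1 hx.2).integral_eq hx.1
    rw [h0, sub_zero] at h3
    rw [← h3]
    refine (sq_intervalIntegral_le hx.1 (h2.mono le_rfl hx.2)).trans ?_
    refine mul_le_mul (by linarith [hx.2]) ?_ (intervalIntegral_sq_nonneg hx.1 _)
      (by linarith)
    exact intervalIntegral.integral_mono_interval le_rfl hx.1 hx.2
      (.of_forall fun y => sq_nonneg _) (h2.intervalIntegrable_sq hαβ)
  have := intervalIntegral.integral_mono_on hαβ
    ((L2On.of_continuousOn (he.continuousOn hαβ)).intervalIntegrable_sq hαβ)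
    (by simp) hpt
  rw [intervalIntegral.integral_const, smul_eq_mul] at this
  linarith

theorem exists_polynomial_derivative_eq {m : ℕ} (p : Polynomial ℝ) (hp : p.degree < m) :
    ∃ P : Polynomial ℝ, P.derivative = p ∧ P.degree < (m + 1 : ℕ) := by
  rcases m with _ | m
  · have : p = 0 := by simpa using hp
    exact ⟨0, by simp [this], by simp⟩
  refine ⟨∑ i ∈ Finset.range (m + 1), Polynomial.monomial (i + 1) (p.coeff i / (i + 1)), ?_, ?_⟩
  · rw [Polynomial.derivative_sum]
    conv_rhs => rw [p.as_sum_range' (m + 1) (by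
      rcases eq_or_ne p 0 with rfl | h
      · simp
      · exact (Polynomial.natDegree_lt_iff_degree_lt h).2 hp)]
    refine Finset.sum_congr rfl fun i _ => ?_
    rw [Polynomial.derivative_monomial]
    have : (i : ℝ) + 1 ≠ 0 := by positivity
    simp [this]
  · refine (Polynomial.degree_sum_le _ _).trans_lt ?_
    refine (Finset.sup_lt_iff (WithBot.bot_lt_coe (m + 1 + 1))).2 fun i hi => ?_
    refine (Polynomial.degree_monomial_le _ _).trans_lt ?_
    have := Finset.mem_range.1 hi
    have h2 : i + 1 < m + 1 + 1 := by omega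
    exact WithBot.coe_lt_coe.2 h2

/-- A function with `m` weak derivatives in `L²` is approximated, up to `h^m` times the norm of the
`m`-th derivative, by a polynomial of degree less than `m`. The constant does not depend on `m`. -/
theorem exists_polynomial_approx {α β : ℝ} (hαβ : α < β) (m : ℕ) (w : ℕ → ℝ → ℝ)
    (hL : ∀ j ≤ m, L2On α β (w j)) (hw : ∀ j < m, HasWeakDeriv 1 α β (w j) (w (j + 1))) :
    ∃ p : Polynomial ℝ, p.degree < m ∧
      ∫ x in α..β, (w 0 x - p.eval x) ^ 2 ≤ ((β - α) ^ m) ^ 2 * ∫ x in α..β, w m x ^ 2 := by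
  induction m generalizing w with
  | zero => exact ⟨0, by simp, by simp⟩
  | succ m ih =>
    obtain ⟨p, hp, hpi⟩ := ih (fun j => w (j + 1)) (fun j hj => hL _ (by omega))
      fun j hj => hw _ (by omega)
    obtain ⟨P, hP, hPd⟩ := exists_polynomial_derivative_eq p hp
    obtain ⟨F, hF, hFw⟩ := (hw 0 (by omega)).exists_hasACDeriv hαβ (hL 0 (by omega)).integrableOn
      (hL 1 (by omega)).integrableOn
    refine ⟨P + Polynomial.C (F α - P.eval α), ?_, ?_⟩
    · refine (Polynomial.degree_add_le _ _).trans_lt (max_lt hPd ?_)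
      refine Polynomial.degree_C_le.trans_lt ?_
      exact_mod_cast Nat.succ_pos m
    · set Q := P + Polynomial.C (F α - P.eval α) with hQ
      have hQ' : Q.derivative = p := by simp [hQ, hP]
      have he := hF.sub (HasACDeriv.polynomial Q)
      rw [hQ'] at he
      have h1 := he.integral_sq_le hαβ.le ((hL 1 (by omega)).sub (L2On.polynomial p))
        (by simp [hQ])
      have h2 : ∫ x in α..β, (w 0 x - Q.eval x) ^ 2 = ∫ x in α..β, (F x - Q.eval x) ^ 2 := by
        rw [← integral_Ioo_eq_interval hαβ.le, ← integral_Ioo_eq_interval hαβ.le]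
        refine integral_congr_ae ?_
        filter_upwards [hFw] with x hx
        rw [hx]
      rw [h2]
      refine h1.trans ((mul_le_mul_of_nonneg_left hpi (sq_nonneg _)).trans_eq ?_)
      ring

/-- Hardy's inequality with the weight `x - z'`, for functions vanishing at the end point `z` of the
interval opposite to `z'`. -/
theorem HasACDeriv.hardy {α β z z' : ℝ} (hle : α ≤ β) (hz : z = β ∧ z' = α ∨ z = α ∧ z' = β)
    {e e' : ℝ → ℝ} (he : HasACDeriv α β e e') (he' : L2On α β e') (hez : e z = 0) :
    ∫ x in α..β, e x ^ 2 ≤ 4 * ∫ x in α..β, ((x - z') * e' x) ^ 2 := by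
  have heL : L2On α β e := L2On.of_continuousOn (he.continuousOn hle)
  have hρe : L2On α β fun x => (x - z') * e' x := he'.mul_continuousOn (by fun_prop)
  have hρ' : HasACDeriv α β (fun x => x - z') (fun _ => 1) := by
    have h := HasACDeriv.of_contDiff (α := α) (β := β) (F := fun x => x - z') (by fun_prop)
    simp only [deriv_sub_const_fun, deriv_id''] at h
    exact h
  have h1 := ((hρ'.mul he).mul he).integral_eq hle
  have h2 : (β - z') * e β * e β - (α - z') * e α * e α = 0 := by
    rcases hz with ⟨rfl, rfl⟩ | ⟨rfl, rfl⟩ <;> rw [hez] <;> ring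
  rw [h2] at h1
  have i1 := heL.intervalIntegrable_sq hle
  have i2 := hρe.intervalIntegrable_mul hle heL
  have i3 := hρe.intervalIntegrable_sq hle
  have h3 : ∫ x in α..β, (1 * e x + (x - z') * e' x) * e x + (x - z') * e x * e' x
      = (∫ x in α..β, e x ^ 2) + 2 * ∫ x in α..β, (x - z') * e' x * e x := by
    rw [← intervalIntegral.integral_const_mul, ← intervalIntegral.integral_add i1 (i2.const_mul 2)]
    exact intervalIntegral.integral_congr fun x _ => by ring
  rw [h3] at h1
  have h4 : 0 ≤ ∫ x in α..β, (e x + 2 * ((x - z') * e' x)) ^ 2 :=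
    intervalIntegral_sq_nonneg hle _
  have h5 : ∫ x in α..β, (e x + 2 * ((x - z') * e' x)) ^ 2 =
      (∫ x in α..β, e x ^ 2) + 4 * (∫ x in α..β, (x - z') * e' x * e x)
        + 4 * ∫ x in α..β, ((x - z') * e' x) ^ 2 := by
    rw [← intervalIntegral.integral_const_mul, ← intervalIntegral.integral_const_mul,
      ← intervalIntegral.integral_add i1 (i2.const_mul 4),
      ← intervalIntegral.integral_add (i1.add (i2.const_mul 4)) (i3.const_mul 4)]
    exact intervalIntegral.integral_congr fun x _ => by ring
  linarith

/-- The error estimate for the Radau projection, with a constant independent of the degree: `p` is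
the polynomial of degree `≤ k` which agrees with `w` at the end point `z` of the interval, and for
which `w - p` is orthogonal to all polynomials of degree `< k`. Then the error of `p` is bounded by
the error of best approximation of `w'` by polynomials of degree `< k`.

The reason is that `p'` is the best approximation of `w'` in the `L²` space with the weight
`|x - z'|`, where `z'` is the other end point, and that the error itself is controlled by the weighted
norm of its derivative through Hardy's inequality. -/
theorem radau_error_le {α β z z' : ℝ} (hαβ : α < β) (hz : z = β ∧ z' = α ∨ z = α ∧ z' = β) (k : ℕ)
    {w w' : ℝ → ℝ} (hw : HasACDeriv α β w w') (hw' : L2On α β w') (p : Polynomial ℝ)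
    (hp : p.degree ≤ k) (hpz : p.eval z = w z)
    (horth : ∀ r : Polynomial ℝ, r.degree < k → ∫ x in α..β, (w x - p.eval x) * r.eval x = 0)
    (q : Polynomial ℝ) (hq : q.degree < k) :
    ∫ x in α..β, (w x - p.eval x) ^ 2 ≤
      4 * ((β - α) ^ 2 * ∫ x in α..β, (w' x - q.eval x) ^ 2) := by
  have hle := hαβ.le
  have hpd : p.derivative.degree < k := by
    rcases eq_or_ne p.derivative 0 with h0 | h0
    · rw [h0, Polynomial.degree_zero]
      exact WithBot.bot_lt_coe k
    · have : p ≠ 0 := fun h => h0 (by simp [h])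
      exact (Polynomial.degree_derivative_lt this).trans_le hp
  set e : ℝ → ℝ := fun x => w x - p.eval x with he_def
  set e' : ℝ → ℝ := fun x => w' x - p.derivative.eval x with he'_def
  have he : HasACDeriv α β e e' := hw.sub (HasACDeriv.polynomial p)
  have he' : L2On α β e' := hw'.sub (L2On.polynomial _)
  have hez : e z = 0 := by simp [he_def, hpz]
  -- the derivative of the error is orthogonal in the weighted sense
  have hort' : ∀ r : Polynomial ℝ, r.degree < k →
      ∫ x in α..β, (x - z') * e' x * r.eval x = 0 := by
    intro r hr
    set v : Polynomial ℝ := (Polynomial.X - Polynomial.C z') * r with hv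
    have hvd : v.derivative.degree < k := by
      rcases eq_or_ne v.derivative 0 with h0 | h0
      · rw [h0, Polynomial.degree_zero]
        exact WithBot.bot_lt_coe k
      · have hv0 : v ≠ 0 := fun h => h0 (by simp [h])
        have hr0 : r ≠ 0 := fun h => hv0 (by simp [hv, h])
        rw [Polynomial.degree_eq_natDegree hr0] at hr
        refine (Polynomial.degree_derivative_lt hv0).trans_le ?_
        rw [hv, Polynomial.degree_mul, Polynomial.degree_X_sub_C,
          Polynomial.degree_eq_natDegree hr0]
        have h3 : r.natDegree < k := by exact_mod_cast hr
        have h4 : 1 + r.natDegree ≤ k := by omega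
        exact_mod_cast h4
    have h1 := he.integral_mul_add (HasACDeriv.polynomial v) hle
    rw [horth _ hvd] at h1
    have hvz : v.eval z' = 0 := by simp [hv]
    have h2 : e β * v.eval β - e α * v.eval α = 0 := by
      rcases hz with ⟨rfl, rfl⟩ | ⟨rfl, rfl⟩ <;> rw [hez, hvz] <;> ring
    rw [h2, add_zero] at h1
    rw [← h1]
    refine intervalIntegral.integral_congr fun x _ => ?_
    simp only [hv, Polynomial.eval_mul, Polynomial.eval_sub, Polynomial.eval_X, Polynomial.eval_C]
    ring
  obtain ⟨s, hs⟩ : ∃ s : ℝ, (∀ x ∈ Icc α β, 0 ≤ s * (x - z')) ∧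
      (∀ x ∈ Icc α β, s * (x - z') ≤ β - α) ∧ s * s = 1 := by
    rcases hz with ⟨rfl, rfl⟩ | ⟨rfl, rfl⟩
    · exact ⟨1, fun x hx => by linarith [hx.1], fun x hx => by linarith [hx.2], by norm_num⟩
    · exact ⟨-1, fun x hx => by linarith [hx.2], fun x hx => by linarith [hx.1], by norm_num⟩
  obtain ⟨hs0, hs1, hss⟩ := hs
  have hρ : ContinuousOn (fun x : ℝ => x - z') (Icc α β) := by fun_prop
  have hρe : L2On α β fun x => (x - z') * e' x := he'.mul_continuousOn hρ
  set d : Polynomial ℝ := p.derivative - q with hd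
  have hdd : d.degree < k := (Polynomial.degree_sub_le _ _).trans_lt (max_lt hpd hq)
  set f : ℝ → ℝ := fun x => w' x - q.eval x with hf
  have hfL : L2On α β f := hw'.sub (L2On.polynomial q)
  have hρf : L2On α β fun x => (x - z') * f x := hfL.mul_continuousOn hρ
  have hρd : L2On α β fun x => (x - z') * d.eval x := (L2On.polynomial d).mul_continuousOn hρ
  -- weighted best approximation
  have hbest : s * ∫ x in α..β, (x - z') * e' x * e' x ≤ s * ∫ x in α..β, (x - z') * f x * f x := by
    have h1 : ∫ x in α..β, (x - z') * f x * f x =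
        (∫ x in α..β, (x - z') * e' x * e' x) + 2 * (∫ x in α..β, (x - z') * e' x * d.eval x)
          + ∫ x in α..β, (x - z') * d.eval x * d.eval x := by
      rw [← intervalIntegral.integral_const_mul, ← intervalIntegral.integral_add
        (hρe.intervalIntegrable_mul hle he')
        ((hρe.intervalIntegrable_mul hle (L2On.polynomial d)).const_mul 2),
        ← intervalIntegral.integral_add ((hρe.intervalIntegrable_mul hle he').add
        ((hρe.intervalIntegrable_mul hle (L2On.polynomial d)).const_mul 2))
        (hρd.intervalIntegrable_mul hle (L2On.polynomial d))]
      refine intervalIntegral.integral_congr fun x _ => ?_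
      simp only [hf, he'_def, hd, Polynomial.eval_sub]
      ring
    have h2 : 0 ≤ s * ∫ x in α..β, (x - z') * d.eval x * d.eval x := by
      rw [← intervalIntegral.integral_const_mul]
      refine intervalIntegral.integral_nonneg hle fun x hx => ?_
      have := mul_nonneg (hs0 x hx) (mul_self_nonneg (d.eval x))
      linarith
    rw [h1, hort' d hdd]
    linarith
  have hhardy : ∫ x in α..β, e x ^ 2 ≤ 4 * ∫ x in α..β, ((x - z') * e' x) ^ 2 :=
    he.hardy hle hz he' hez
  have h6 : ∫ x in α..β, ((x - z') * e' x) ^ 2 ≤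
      (β - α) * (s * ∫ x in α..β, (x - z') * e' x * e' x) := by
    rw [← intervalIntegral.integral_const_mul, ← intervalIntegral.integral_const_mul]
    refine intervalIntegral.integral_mono_on hle (hρe.intervalIntegrable_sq hle)
      (((hρe.intervalIntegrable_mul hle he').const_mul s).const_mul _) fun x hx => ?_
    have h7 := mul_nonneg (mul_nonneg (sub_nonneg.2 (hs1 x hx)) (hs0 x hx)) (sq_nonneg (e' x))
    have h8 : ((x - z') * e' x) ^ 2 = (s * s) * ((x - z') * e' x) ^ 2 := by rw [hss, one_mul]
    rw [h8]
    linarith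
  have h7 : s * ∫ x in α..β, (x - z') * f x * f x ≤ (β - α) * ∫ x in α..β, f x ^ 2 := by
    rw [← intervalIntegral.integral_const_mul, ← intervalIntegral.integral_const_mul]
    refine intervalIntegral.integral_mono_on hle ((hρf.intervalIntegrable_mul hle hfL).const_mul s)
      ((hfL.intervalIntegrable_sq hle).const_mul _) fun x hx => ?_
    have := mul_nonneg (sub_nonneg.2 (hs1 x hx)) (sq_nonneg (f x))
    linarith
  have h8 : 0 ≤ β - α := by linarith
  nlinarith [mul_le_mul_of_nonneg_left (hbest.trans h7) h8]

/-- The pairing `∫ p r` of polynomials on an interval. -/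
noncomputable def polyPairing (α β : ℝ) : Polynomial ℝ →ₗ[ℝ] Polynomial ℝ →ₗ[ℝ] ℝ :=
  LinearMap.mk₂ ℝ (fun p r => ∫ x in α..β, p.eval x * r.eval x)
    (fun p p' r => by
      rw [← intervalIntegral.integral_add]
      · simp only [Polynomial.eval_add, add_mul]
      · exact (p.continuous.mul r.continuous).intervalIntegrable _ _
      · exact (p'.continuous.mul r.continuous).intervalIntegrable _ _)
    (fun c p r => by
      rw [smul_eq_mul, ← intervalIntegral.integral_const_mul]
      simp only [Polynomial.eval_smul, smul_eq_mul, mul_assoc])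
    (fun p r r' => by
      rw [← intervalIntegral.integral_add]
      · simp only [Polynomial.eval_add, mul_add]
      · exact (p.continuous.mul r.continuous).intervalIntegrable _ _
      · exact (p.continuous.mul r'.continuous).intervalIntegrable _ _)
    (fun c p r => by
      rw [smul_eq_mul, ← intervalIntegral.integral_const_mul]
      simp only [Polynomial.eval_smul, smul_eq_mul]
      exact intervalIntegral.integral_congr fun x _ => by ring)

theorem polynomial_eq_zero_of_integral_sq {α β : ℝ} (hαβ : α < β) {p : Polynomial ℝ}
    (h : ∫ x in α..β, p.eval x ^ 2 ≤ 0) : p = 0 := by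
  by_contra hp
  have hfin : {x : ℝ | p.eval x = 0}.Finite := by
    refine (p.roots.toFinset.finite_toSet).subset fun x hx => ?_
    simpa [hp] using hx
  obtain ⟨c, hc, hc0⟩ : ∃ c ∈ Ioo α β, p.eval c ≠ 0 := by
    obtain ⟨c, hc, hc'⟩ := (Ioo_infinite hαβ).exists_notMem_finite hfin
    exact ⟨c, hc, hc'⟩
  have : 0 < ∫ x in α..β, p.eval x ^ 2 :=
    intervalIntegral.integral_pos hαβ (by fun_prop) (fun x _ => sq_nonneg _)
      ⟨c, Ioo_subset_Icc_self hc, by positivity⟩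
  linarith

/-- Existence of the Radau projection. -/
theorem exists_radau {α β z z' : ℝ} (hαβ : α < β) (hz : z = β ∧ z' = α ∨ z = α ∧ z' = β) (k : ℕ)
    {w : ℝ → ℝ} (hw : ContinuousOn w (Icc α β)) :
    ∃ p : Polynomial.degreeLE ℝ (k : WithBot ℕ), (p : Polynomial ℝ).eval z = w z ∧
      ∀ r : Polynomial ℝ, r.degree < k →
        ∫ x in α..β, (w x - (p : Polynomial ℝ).eval x) * r.eval x = 0 := by
  let D := Polynomial.degreeLT ℝ k
  let A : Polynomial.degreeLE ℝ (k : WithBot ℕ) →ₗ[ℝ] Module.Dual ℝ D × ℝ :=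
    (((LinearMap.lcomp ℝ ℝ D.subtype).comp (polyPairing α β)).prod (Polynomial.leval z)).comp
      (Submodule.subtype _)
  have hA1 : ∀ p (r : D), (A p).1 r = ∫ x in α..β, (p : Polynomial ℝ).eval x *
      (r : Polynomial ℝ).eval x := fun p r => rfl
  have hA2 : ∀ p, (A p).2 = (p : Polynomial ℝ).eval z := fun p => rfl
  have hinj : Function.Injective A := by
    rw [injective_iff_map_eq_zero]
    intro p hp
    have h1 := radau_error_le hαβ hz k (HasACDeriv.const 0) (by simp) (p : Polynomial ℝ)
      (Polynomial.mem_degreeLE.1 p.2) (by rw [← hA2, hp]; rfl) (fun r hr => by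
        have := hA1 p ⟨r, Polynomial.mem_degreeLT.2 hr⟩
        rw [hp] at this
        simp only [zero_sub, neg_mul, intervalIntegral.integral_neg, neg_eq_zero]
        exact this.symm) 0 (by rw [Polynomial.degree_zero]; exact WithBot.bot_lt_coe k)
    simp only [zero_sub, neg_sq, Polynomial.eval_zero, sub_zero, ne_eq, OfNat.ofNat_ne_zero,
      not_false_eq_true, zero_pow, intervalIntegral.integral_zero, mul_zero] at h1
    exact Subtype.ext (polynomial_eq_zero_of_integral_sq hαβ h1)
  have hE : Polynomial.degreeLE ℝ (k : WithBot ℕ) = Polynomial.degreeLT ℝ (k + 1) :=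
    Polynomial.degreeLT_succ_eq_degreeLE.symm
  have : FiniteDimensional ℝ (Polynomial.degreeLT ℝ (k + 1)) :=
    (Polynomial.degreeLTEquiv ℝ (k + 1)).symm.finiteDimensional
  have : FiniteDimensional ℝ D := (Polynomial.degreeLTEquiv ℝ k).symm.finiteDimensional
  have : FiniteDimensional ℝ (Polynomial.degreeLE ℝ (k : WithBot ℕ)) := by rw [hE]; infer_instance
  have hfin : Module.finrank ℝ (Polynomial.degreeLE ℝ (k : WithBot ℕ)) =
      Module.finrank ℝ (Module.Dual ℝ D × ℝ) := by
    rw [hE, Module.finrank_prod, Subspace.dual_finrank_eq,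
      (Polynomial.degreeLTEquiv ℝ (k + 1)).finrank_eq, (Polynomial.degreeLTEquiv ℝ k).finrank_eq]
    simp
  have hsurj := (LinearMap.injective_iff_surjective_of_finrank_eq_finrank hfin).1 hinj
  have hwr : ∀ r : Polynomial ℝ, IntervalIntegrable (fun x => w x * r.eval x) volume α β :=
    fun r => ContinuousOn.intervalIntegrable (by
      rw [uIcc_of_le hαβ.le]
      exact hw.mul r.continuous.continuousOn)
  let ℓ : Module.Dual ℝ D :=
    { toFun := fun r => ∫ x in α..β, w x * (r : Polynomial ℝ).eval x
      map_add' := fun r r' => by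
        rw [← intervalIntegral.integral_add (hwr _) (hwr _)]
        simp [mul_add]
      map_smul' := fun c r => by
        rw [RingHom.id_apply, smul_eq_mul, ← intervalIntegral.integral_const_mul]
        refine intervalIntegral.integral_congr fun x _ => ?_
        simp only [Submodule.coe_smul, Polynomial.eval_smul, smul_eq_mul]
        ring }
  obtain ⟨p, hp⟩ := hsurj (ℓ, w z)
  refine ⟨p, by rw [← hA2, hp], fun r hr => ?_⟩
  have h1 := hA1 p ⟨r, Polynomial.mem_degreeLT.2 hr⟩
  rw [hp] at h1
  have h2 : ∫ x in α..β, w x * r.eval x = ∫ x in α..β, (p : Polynomial ℝ).eval x * r.eval x := h1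
  simp only [sub_mul]
  have h3 : IntervalIntegrable (fun x => (p : Polynomial ℝ).eval x * r.eval x) volume α β :=
    ((p : Polynomial ℝ).continuous.mul r.continuous).intervalIntegrable _ _
  rw [intervalIntegral.integral_sub (hwr r) h3, h2, sub_self]

/-! ### The `L²` space of the network -/

namespace Network

variable {V : Type u} (N : Network V)

theorem L2.l2On {N : Network V} (f : N.L2) (e : N.E) : L2On 0 (N.len e) (f e) := Lp.memLp (f e)

theorem inner_eq_sum (f g : N.L2) :
    inner ℝ f g = ∑ e, ∫ x in (0 : ℝ)..N.len e, f e x * g e x := by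
  rw [PiLp.inner_apply]
  refine Finset.sum_congr rfl fun e _ => ?_
  rw [L2.inner_def, ← integral_Ioo_eq_interval (N.len_pos e).le]
  exact integral_congr_ae (.of_forall fun x => by simp [mul_comm])

theorem norm_sq_eq_sum (f : N.L2) :
    ‖f‖ ^ 2 = ∑ e, ∫ x in (0 : ℝ)..N.len e, f e x ^ 2 := by
  rw [← real_inner_self_eq_norm_sq, inner_eq_sum]
  simp only [sq]

/-- A measurable coefficient with values in `[a₀, A]`, where `a₀ > 0`. -/
structure IsWeight (a₀ A : ℝ) (a : N.E → ℝ → ℝ) : Prop where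
  pos : 0 < a₀
  meas : ∀ e, AEStronglyMeasurable (a e) (N.vol e)
  bound : ∀ e, ∀ᵐ x ∂(N.vol e), a₀ ≤ a e x ∧ a e x ≤ A

variable {N} {a₀ A : ℝ} {a : N.E → ℝ → ℝ}

theorem IsWeight.l2On (ha : N.IsWeight a₀ A a) {e : N.E} {f : ℝ → ℝ}
    (hf : L2On 0 (N.len e) f) : L2On 0 (N.len e) fun x => a e x * f x := by
  refine MemLp.of_le_mul (c := A) hf ((ha.meas e).mul hf.1) ?_
  filter_upwards [ha.bound e] with x hx
  rw [norm_mul, Real.norm_of_nonneg (ha.pos.le.trans hx.1)]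
  exact mul_le_mul_of_nonneg_right hx.2 (norm_nonneg _)

theorem IsWeight.intervalIntegrable (ha : N.IsWeight a₀ A a) {e : N.E} {f g : ℝ → ℝ}
    (hf : L2On 0 (N.len e) f) (hg : L2On 0 (N.len e) g) :
    IntervalIntegrable (fun x => a e x * f x * g x) volume 0 (N.len e) :=
  (ha.l2On hf).intervalIntegrable_mul (N.len_pos e).le hg

theorem intervalIntegral_congr_ae_vol {e : N.E} {f g : ℝ → ℝ} (h : f =ᵐ[N.vol e] g) :
    ∫ x in (0 : ℝ)..N.len e, f x = ∫ x in (0 : ℝ)..N.len e, g x := by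
  rw [← integral_Ioo_eq_interval (N.len_pos e).le, ← integral_Ioo_eq_interval (N.len_pos e).le]
  exact integral_congr_ae h

/-- The weighted inner product `∑ e, ∫ a f g` on the `L²` space of the network. -/
noncomputable def aForm (ha : N.IsWeight a₀ A a) : N.L2 →ₗ[ℝ] N.L2 →ₗ[ℝ] ℝ :=
  LinearMap.mk₂ ℝ (fun f g => ∑ e, ∫ x in (0 : ℝ)..N.len e, a e x * f e x * g e x)
    (fun f f' g => by
      rw [← Finset.sum_add_distrib]
      refine Finset.sum_congr rfl fun e _ => ?_
      rw [← intervalIntegral.integral_add (ha.intervalIntegrable (L2.l2On f e) (L2.l2On g e))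
        (ha.intervalIntegrable (L2.l2On f' e) (L2.l2On g e))]
      refine intervalIntegral_congr_ae_vol ?_
      filter_upwards [Lp.coeFn_add (f e) (f' e)] with x hx
      rw [PiLp.add_apply, hx, Pi.add_apply]
      ring)
    (fun c f g => by
      rw [smul_eq_mul, Finset.mul_sum]
      refine Finset.sum_congr rfl fun e _ => ?_
      rw [← intervalIntegral.integral_const_mul]
      refine intervalIntegral_congr_ae_vol ?_
      filter_upwards [Lp.coeFn_smul c (f e)] with x hx
      rw [PiLp.smul_apply, hx, Pi.smul_apply, smul_eq_mul]
      ring)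
    (fun f g g' => by
      rw [← Finset.sum_add_distrib]
      refine Finset.sum_congr rfl fun e _ => ?_
      rw [← intervalIntegral.integral_add (ha.intervalIntegrable (L2.l2On f e) (L2.l2On g e))
        (ha.intervalIntegrable (L2.l2On f e) (L2.l2On g' e))]
      refine intervalIntegral_congr_ae_vol ?_
      filter_upwards [Lp.coeFn_add (g e) (g' e)] with x hx
      rw [PiLp.add_apply, hx, Pi.add_apply]
      ring)
    (fun c f g => by
      rw [smul_eq_mul, Finset.mul_sum]
      refine Finset.sum_congr rfl fun e _ => ?_
      rw [← intervalIntegral.integral_const_mul]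
      refine intervalIntegral_congr_ae_vol ?_
      filter_upwards [Lp.coeFn_smul c (g e)] with x hx
      rw [PiLp.smul_apply, hx, Pi.smul_apply, smul_eq_mul]
      ring)

theorem aForm_apply (ha : N.IsWeight a₀ A a) (f g : N.L2) :
    aForm ha f g = ∑ e, ∫ x in (0 : ℝ)..N.len e, a e x * f e x * g e x := rfl

theorem aForm_symm (ha : N.IsWeight a₀ A a) (f g : N.L2) : aForm ha f g = aForm ha g f := by
  simp only [aForm_apply]
  refine Finset.sum_congr rfl fun e _ => intervalIntegral.integral_congr fun x _ => ?_
  ring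

theorem le_aForm (ha : N.IsWeight a₀ A a) (f : N.L2) : a₀ * ‖f‖ ^ 2 ≤ aForm ha f f := by
  rw [norm_sq_eq_sum, aForm_apply, Finset.mul_sum]
  refine Finset.sum_le_sum fun e _ => ?_
  have hle := (N.len_pos e).le
  rw [← intervalIntegral.integral_const_mul, ← integral_Ioo_eq_interval hle,
    ← integral_Ioo_eq_interval hle]
  refine integral_mono_ae ((intervalIntegrable_iff_integrableOn_Ioo_of_le hle).1
    (((L2.l2On f e).intervalIntegrable_sq hle).const_mul _))
    ((intervalIntegrable_iff_integrableOn_Ioo_of_le hle).1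
    (ha.intervalIntegrable (L2.l2On f e) (L2.l2On f e))) ?_
  filter_upwards [ha.bound e] with x hx
  have := mul_nonneg (sub_nonneg.2 hx.1) (sq_nonneg (f e x))
  linarith

theorem aForm_le (ha : N.IsWeight a₀ A a) (f : N.L2) : aForm ha f f ≤ A * ‖f‖ ^ 2 := by
  rw [norm_sq_eq_sum, aForm_apply, Finset.mul_sum]
  refine Finset.sum_le_sum fun e _ => ?_
  have hle := (N.len_pos e).le
  rw [← intervalIntegral.integral_const_mul, ← integral_Ioo_eq_interval hle,
    ← integral_Ioo_eq_interval hle]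
  refine integral_mono_ae ((intervalIntegrable_iff_integrableOn_Ioo_of_le hle).1
    (ha.intervalIntegrable (L2.l2On f e) (L2.l2On f e)))
    ((intervalIntegrable_iff_integrableOn_Ioo_of_le hle).1
    (((L2.l2On f e).intervalIntegrable_sq hle).const_mul _)) ?_
  filter_upwards [ha.bound e] with x hx
  have := mul_nonneg (sub_nonneg.2 hx.2) (sq_nonneg (f e x))
  linarith

theorem two_mul_aForm_le (ha : N.IsWeight a₀ A a) (f g : N.L2) :
    2 * aForm ha f g ≤ aForm ha f f + aForm ha g g := by
  have h := (mul_nonneg ha.pos.le (sq_nonneg ‖f - g‖)).trans (le_aForm ha (f - g))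
  simp only [map_sub, LinearMap.sub_apply] at h
  have h1 := aForm_symm ha f g
  linarith

end Network

/-! ### Meshes -/

theorem sum_fin_telescope {n : ℕ} (f : Fin (n + 1) → ℝ) :
    ∑ i : Fin n, (f i.succ - f i.castSucc) = f (Fin.last n) - f 0 := by
  rw [Finset.sum_sub_distrib]
  have h1 := Fin.sum_univ_succ f
  have h2 := Fin.sum_univ_castSucc f
  linarith

namespace Mesh

variable {V : Type u} {N : Network V} (M : Mesh N)

theorem left_lt_right (τ : M.Elem) : M.left τ < M.right τ :=
  M.strictMono τ.1 Fin.castSucc_lt_succ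

theorem pt_nonneg (e : N.E) (j : Fin (M.num e + 1)) : 0 ≤ M.pt e j := by
  rw [← M.pt_zero e]
  exact (M.strictMono e).monotone (Fin.zero_le j)

theorem pt_le_len (e : N.E) (j : Fin (M.num e + 1)) : M.pt e j ≤ N.len e := by
  rw [← M.pt_last e]
  exact (M.strictMono e).monotone (Fin.le_last j)

theorem left_nonneg (τ : M.Elem) : 0 ≤ M.left τ := M.pt_nonneg _ _

theorem right_le_len (τ : M.Elem) : M.right τ ≤ N.len τ.1 := M.pt_le_len _ _

theorem Icc_subset (τ : M.Elem) : Icc (M.left τ) (M.right τ) ⊆ Icc 0 (N.len τ.1) :=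
  Icc_subset_Icc (M.left_nonneg τ) (M.right_le_len τ)

theorem last_ne_zero (e : N.E) : Fin.last (M.num e) ≠ 0 := by
  intro h
  have h1 := M.pt_last e
  rw [h, M.pt_zero] at h1
  exact (N.len_pos e).ne h1

theorem node_zero (e : N.E) : M.node e 0 = Sum.inl e.1.1 := by simp [node]

theorem node_last (e : N.E) : M.node e (Fin.last _) = Sum.inl e.1.2 := by
  simp [node, M.last_ne_zero e]

theorem length_le_h (τ : M.Elem) : M.right τ - M.left τ ≤ M.h :=
  le_ciSup (f := fun τ : M.Elem => M.right τ - M.left τ) (Set.finite_range _).bddAbove τ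

theorem h_nonneg : 0 ≤ M.h :=
  Real.iSup_nonneg fun τ => sub_nonneg.2 (M.left_lt_right τ).le

theorem sum_elem_eq (φ : M.Elem → ℝ) :
    ∑ τ : M.Elem, φ τ = ∑ e, ∑ i : Fin (M.num e), φ ⟨e, i⟩ := Fintype.sum_sigma _

theorem sum_elem_telescope (b : N.E → ℝ) (f : (e : N.E) → Fin (M.num e + 1) → ℝ) :
    ∑ τ : M.Elem, b τ.1 * (f τ.1 τ.2.succ - f τ.1 τ.2.castSucc) =
      ∑ e, b e * (f e (Fin.last _) - f e 0) := by
  rw [sum_elem_eq]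
  refine Finset.sum_congr rfl fun e _ => ?_
  rw [← sum_fin_telescope (f e), Finset.mul_sum]

theorem sum_elem_integral {φ : N.E → ℝ → ℝ}
    (hφ : ∀ e, IntervalIntegrable (φ e) volume 0 (N.len e)) :
    ∑ τ : M.Elem, ∫ x in M.left τ..M.right τ, φ τ.1 x = ∑ e, ∫ x in (0 : ℝ)..N.len e, φ e x := by
  have h := M.sum_elem_telescope (fun _ => 1) fun e j => ∫ x in (0 : ℝ)..M.pt e j, φ e x
  simp only [one_mul, M.pt_zero, M.pt_last, intervalIntegral.integral_same, sub_zero] at h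
  rw [← h]
  have hi : ∀ e (j : Fin (M.num e + 1)), IntervalIntegrable (φ e) volume 0 (M.pt e j) :=
    fun e j => (hφ e).mono_set (by
      rw [uIcc_of_le (M.pt_nonneg e j), uIcc_of_le (N.len_pos e).le]
      exact Icc_subset_Icc_right (M.pt_le_len e j))
  refine Finset.sum_congr rfl fun τ _ => ?_
  exact (intervalIntegral.integral_interval_sub_left (hi _ _) (hi _ _)).symm

theorem toFun_eq {k : ℕ} (w : M.W k) (τ : M.Elem) {x : ℝ}
    (hx : x ∈ Ioo (M.left τ) (M.right τ)) : M.toFun w τ.1 x = (w τ : Polynomial ℝ).eval x := by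
  obtain ⟨e, i⟩ := τ
  simp only [toFun]
  rw [Finset.sum_eq_single i, indicator_of_mem hx]
  · intro j _ hj
    refine indicator_of_notMem (fun hxj => ?_) _
    rcases lt_or_gt_of_ne hj with h | h
    · have : M.pt e j.succ ≤ M.pt e i.castSucc := (M.strictMono e).monotone (by
        rw [Fin.le_def]; simpa using h)
      exact lt_irrefl x (hxj.2.trans_le (this.trans hx.1.le))
    · have : M.pt e i.succ ≤ M.pt e j.castSucc := (M.strictMono e).monotone (by
        rw [Fin.le_def]; simpa using h)
      exact lt_irrefl x (hx.2.trans_le (this.trans hxj.1.le))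
  · simp

theorem toL2_ae {k : ℕ} (w : M.W k) (τ : M.Elem) :
    M.toL2 w τ.1 =ᵐ[volume.restrict (Ioo (M.left τ) (M.right τ))]
      fun x => (w τ : Polynomial ℝ).eval x := by
  have h1 : M.toL2 w τ.1 =ᵐ[N.vol τ.1] M.toFun w τ.1 := (M.memLp_toFun w τ.1).coeFn_toLp
  have h2 := ae_restrict_of_ae_restrict_of_subset
    (Ioo_subset_Ioo (M.left_nonneg τ) (M.right_le_len τ)) h1
  filter_upwards [h2, ae_restrict_mem measurableSet_Ioo] with x hx hx'
  rw [hx, M.toFun_eq w τ hx']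

theorem integral_congr_elem (τ : M.Elem) {f g : ℝ → ℝ}
    (h : f =ᵐ[volume.restrict (Ioo (M.left τ) (M.right τ))] g) :
    ∫ x in M.left τ..M.right τ, f x = ∫ x in M.left τ..M.right τ, g x := by
  rw [← integral_Ioo_eq_interval (M.left_lt_right τ).le,
    ← integral_Ioo_eq_interval (M.left_lt_right τ).le]
  exact integral_congr_ae h

theorem restrict_elem_ae {τ : M.Elem} {p : ℝ → Prop} (h : ∀ᵐ x ∂(N.vol τ.1), p x) :
    ∀ᵐ x ∂(volume.restrict (Ioo (M.left τ) (M.right τ))), p x :=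
  ae_restrict_of_ae_restrict_of_subset
    (Ioo_subset_Ioo (M.left_nonneg τ) (M.right_le_len τ)) h

/-- Two elements of `L²` agree if they agree on every element of the mesh. -/
theorem L2_ext {f g : N.L2}
    (h : ∀ τ : M.Elem, f τ.1 =ᵐ[volume.restrict (Ioo (M.left τ) (M.right τ))] g τ.1) : f = g := by
  rw [← sub_eq_zero, ← norm_eq_zero, ← sq_eq_zero_iff, Network.norm_sq_eq_sum,
    ← M.sum_elem_integral fun e => (Network.L2.l2On (f - g) e).intervalIntegrable_sq (N.len_pos e).le]
  refine Finset.sum_eq_zero fun τ _ => ?_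
  rw [M.integral_congr_elem τ (g := fun _ => 0), intervalIntegral.integral_zero]
  filter_upwards [h τ, M.restrict_elem_ae (Lp.coeFn_sub (f τ.1) (g τ.1))] with x h1 h2
  rw [PiLp.sub_apply, h2, Pi.sub_apply, h1, sub_self, zero_pow two_ne_zero]

theorem toL2_add {k : ℕ} (w w' : M.W k) : M.toL2 (w + w') = M.toL2 w + M.toL2 w' := by
  refine M.L2_ext fun τ => ?_
  filter_upwards [M.toL2_ae w τ, M.toL2_ae w' τ, M.toL2_ae (w + w') τ,
    M.restrict_elem_ae (Lp.coeFn_add (M.toL2 w τ.1) (M.toL2 w' τ.1))] with x h1 h2 h3 h4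
  rw [PiLp.add_apply, h4, Pi.add_apply, h1, h2, h3]
  simp

theorem toL2_smul {k : ℕ} (c : ℝ) (w : M.W k) : M.toL2 (c • w) = c • M.toL2 w := by
  refine M.L2_ext fun τ => ?_
  filter_upwards [M.toL2_ae w τ, M.toL2_ae (c • w) τ,
    M.restrict_elem_ae (Lp.coeFn_smul c (M.toL2 w τ.1))] with x h1 h2 h3
  rw [PiLp.smul_apply, h3, Pi.smul_apply, h1, h2]
  simp

/-- The inclusion of `W_h` into `L²` as a linear map. -/
noncomputable def toL2Lin (k : ℕ) : M.W k →ₗ[ℝ] N.L2 where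
  toFun := M.toL2
  map_add' := M.toL2_add
  map_smul' := M.toL2_smul

theorem toL2_sub {k : ℕ} (w w' : M.W k) : M.toL2 (w - w') = M.toL2 w - M.toL2 w' :=
  map_sub (M.toL2Lin k) w w'

theorem toL2_injective {k : ℕ} : Function.Injective (M.toL2 (k := k)) := by
  change Function.Injective (M.toL2Lin k)
  rw [injective_iff_map_eq_zero]
  intro w hw
  ext1 τ
  refine Subtype.ext (polynomial_eq_zero_of_integral_sq (M.left_lt_right τ) (le_of_eq ?_))
  rw [M.integral_congr_elem τ (g := fun _ => 0), intervalIntegral.integral_zero]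
  have h0 : M.toL2 w = 0 := hw
  have h1 := M.toL2_ae w τ
  rw [h0] at h1
  filter_upwards [h1, M.restrict_elem_ae (Lp.coeFn_zero ℝ 2 (N.vol τ.1))] with x hx hx'
  rw [PiLp.zero_apply, hx', Pi.zero_apply] at hx
  rw [← hx, zero_pow two_ne_zero]

/-- The weighted inner product with an element of `W_h`, as a sum over the elements. -/
theorem aForm_toL2 {a₀ A : ℝ} {a : N.E → ℝ → ℝ} (ha : N.IsWeight a₀ A a) {k : ℕ} (f : N.L2)
    (w : M.W k) : Network.aForm ha f (M.toL2 w) =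
      ∑ τ : M.Elem, ∫ x in M.left τ..M.right τ,
        a τ.1 x * f τ.1 x * (w τ : Polynomial ℝ).eval x := by
  rw [Network.aForm_apply, ← M.sum_elem_integral fun e =>
    ha.intervalIntegrable (Network.L2.l2On f e) (Network.L2.l2On (M.toL2 w) e)]
  refine Finset.sum_congr rfl fun τ _ => M.integral_congr_elem τ ?_
  filter_upwards [M.toL2_ae w τ] with x hx
  rw [hx]

theorem norm_sq_eq_sum_elem (f : N.L2) :
    ‖f‖ ^ 2 = ∑ τ : M.Elem, ∫ x in M.left τ..M.right τ, f τ.1 x ^ 2 := by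
  rw [Network.norm_sq_eq_sum, M.sum_elem_integral fun e =>
    (Network.L2.l2On f e).intervalIntegrable_sq (N.len_pos e).le]

theorem inner_toL2 {k : ℕ} (f : N.L2) (w : M.W k) : inner ℝ f (M.toL2 w) =
      ∑ τ : M.Elem, ∫ x in M.left τ..M.right τ, f τ.1 x * (w τ : Polynomial ℝ).eval x := by
  rw [Network.inner_eq_sum, ← M.sum_elem_integral fun e =>
    (Network.L2.l2On f e).intervalIntegrable_mul (N.len_pos e).le (Network.L2.l2On (M.toL2 w) e)]
  refine Finset.sum_congr rfl fun τ _ => M.integral_congr_elem τ ?_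
  filter_upwards [M.toL2_ae w τ] with x hx
  rw [hx]

end Mesh

/-! ### Summation over the vertices -/

namespace Network

variable {V : Type u} [DecidableEq V] (N : Network V)

theorem n_start (e : N.E) : N.n e e.1.1 = -1 := by simp [n]

theorem n_end (e : N.E) : N.n e e.1.2 = 1 := by simp [n, N.loopless e.1 e.2]

theorem coord_start (e : N.E) : N.coord e e.1.1 = 0 := by simp [coord]

theorem coord_end (e : N.E) : N.coord e e.1.2 = N.len e := by simp [coord, N.loopless e.1 e.2]

theorem mem_edgesAt_of_n_ne {e : N.E} {v : V} (h : N.n e v ≠ 0) : e ∈ N.edgesAt v := by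
  simp only [edgesAt, Finset.mem_filter, Finset.mem_univ, true_and]
  by_contra hc
  rw [not_or] at hc
  exact h (by simp [n, hc.1, hc.2])

theorem sum_vertices [Fintype V] (G : N.E → V → ℝ) :
    ∑ v, ∑ e ∈ N.edgesAt v, N.n e v * G e v = ∑ e, (G e e.1.2 - G e e.1.1) := by
  have h1 : ∀ v, ∑ e ∈ N.edgesAt v, N.n e v * G e v = ∑ e, N.n e v * G e v := fun v =>
    Finset.sum_subset (Finset.subset_univ _) fun e _ he => by
      by_contra hc
      exact he (N.mem_edgesAt_of_n_ne fun h => hc (by rw [h, zero_mul]))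
  simp only [h1]
  rw [Finset.sum_comm]
  refine Finset.sum_congr rfl fun e _ => ?_
  have h2 : ∀ v, N.n e v * G e v =
      (if e.1.2 = v then G e v else 0) - (if e.1.1 = v then G e v else 0) := by
    intro v
    have := N.loopless e.1 e.2
    by_cases ha : e.1.1 = v
    · have hb : ¬ e.1.2 = v := fun h => this (ha.trans h.symm)
      simp [n, ha, hb]
    · by_cases hb : e.1.2 = v <;> simp [n, ha, hb]
  simp only [h2, Finset.sum_sub_distrib, Finset.sum_ite_eq, Finset.mem_univ, if_true]

variable {N}

theorem IsOutflow.sum_nonneg {b : N.E → ℝ} {v : V} (h : N.IsOutflow b v) :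
    0 ≤ ∑ e ∈ N.edgesAt v, b e * N.n e v := by
  obtain ⟨h1, e, he, hb⟩ := h
  have h2 : (N.edgesAt v).card ≤ 1 := by
    unfold IsInner at h1
    omega
  refine Finset.sum_nonneg fun e' he' => ?_
  rw [Finset.card_le_one.1 h2 e' he' e he]
  exact hb.le

theorem eq_zero_of_not_boundary_flow {b : N.E → ℝ} {v : V} (h0 : ¬ N.IsInner v)
    (h1 : ¬ N.IsInflow b v) (h2 : ¬ N.IsOutflow b v) {e : N.E} (he : e ∈ N.edgesAt v) :
    b e * N.n e v = 0 := by
  rcases lt_trichotomy (b e * N.n e v) 0 with h | h | h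
  · exact absurd ⟨h0, e, he, h⟩ h1
  · exact h
  · exact absurd ⟨h0, e, he, h⟩ h2

/-- The coupling conditions say that the net flux computed from the edges agrees with the one computed
from the hybrid variable. -/
theorem sum_flux_eq {b : N.E → ℝ} {v : V} {F : N.E → ℝ} {c : ℝ}
    (hout : ∀ e ∈ N.outEdges b v, F e = c)
    (hin : ∑ e ∈ N.inEdges b v, b e * N.n e v * c = ∑ e ∈ N.inEdges b v, b e * N.n e v * F e) :
    ∑ e ∈ N.edgesAt v, b e * N.n e v * F e = ∑ e ∈ N.edgesAt v, b e * N.n e v * c := by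
  have key : ∀ G : N.E → ℝ, ∑ e ∈ N.edgesAt v, b e * N.n e v * G e =
      ∑ e ∈ N.inEdges b v, b e * N.n e v * G e + ∑ e ∈ N.outEdges b v, b e * N.n e v * G e := by
    intro G
    have hd : Disjoint (N.inEdges b v) (N.outEdges b v) := by
      rw [Finset.disjoint_left]
      intro e h1 h2
      simp only [inEdges, outEdges, Finset.mem_filter] at h1 h2
      linarith [h1.2, h2.2]
    rw [← Finset.sum_union hd]
    symm
    refine Finset.sum_subset (fun e he => ?_) fun e _ he' => ?_
    · refine N.mem_edgesAt_of_n_ne fun h => ?_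
      simp only [inEdges, outEdges, Finset.mem_union, Finset.mem_filter, h, mul_zero,
        lt_irrefl, and_false, or_false] at he
    · simp only [inEdges, outEdges, Finset.mem_union, Finset.mem_filter, Finset.mem_univ,
        true_and, not_or, not_lt] at he'
      rw [le_antisymm he'.1 he'.2, zero_mul]
  rw [key, key, hin]
  congr 1
  exact Finset.sum_congr rfl fun e he => by rw [hout e he]

end Network

/-! ### Stability and consistency of the bilinear form -/

namespace Mesh

variable {V : Type u} {N : Network V} (M : Mesh N)

theorem sum_elem_node [Fintype V] [DecidableEq V] (b : N.E → ℝ) (c : M.GridPt → ℝ) :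
    ∑ τ : M.Elem, b τ.1 * (c (M.nodeR τ) - c (M.nodeL τ)) =
      ∑ v, ∑ e ∈ N.edgesAt v, b e * N.n e v * c (Sum.inl v) := by
  have h1 := M.sum_elem_telescope b fun e j => c (M.node e j)
  simp only [M.node_zero, M.node_last] at h1
  have h2 := N.sum_vertices fun e v => b e * c (Sum.inl v)
  simp only [← mul_sub] at h2
  rw [← h2] at h1
  refine h1.trans (Finset.sum_congr rfl fun v _ => Finset.sum_congr rfl fun e _ => ?_)
  ring

theorem upwind_energy (b eL eR cL cR : ℝ) :
    -(b * ((eR ^ 2 - eL ^ 2) / 2)) + (upwind (-b) eL cL * (eL - cL) + upwind b eR cR * (eR - cR))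
      ≥ -(b * (cR ^ 2 - cL ^ 2)) / 2 := by
  unfold upwind
  rcases le_total 0 b with h | h
  · rw [max_eq_left h, min_eq_right h, max_eq_right (neg_nonpos.2 h), min_eq_left (neg_nonpos.2 h)]
    nlinarith [mul_nonneg h (sq_nonneg (eL - cL)), mul_nonneg h (sq_nonneg (eR - cR))]
  · rw [max_eq_right h, min_eq_left h, max_eq_left (neg_nonneg.2 h), min_eq_right (neg_nonneg.2 h)]
    nlinarith [mul_nonneg (neg_nonneg.2 h) (sq_nonneg (eL - cL)),
      mul_nonneg (neg_nonneg.2 h) (sq_nonneg (eR - cR))]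

/-- The bilinear form is nonnegative on the diagonal: upwinding is dissipative. -/
theorem bilin_self_nonneg [Fintype V] [DecidableEq V] {k : ℕ} {b : N.E → ℝ}
    (hb : N.FlowConservation b) (w : M.W k) (c : M.GridPt → ℝ)
    (hc : ∀ v, N.IsInflow b v → c (Sum.inl v) = 0) : 0 ≤ M.bilin b w c w c := by
  classical
  have hvol : ∀ τ : M.Elem, ∫ x in M.left τ..M.right τ,
      b τ.1 * (w τ : Polynomial ℝ).eval x * (w τ : Polynomial ℝ).derivative.eval x =
      b τ.1 * (((w τ : Polynomial ℝ).eval (M.right τ) ^ 2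
        - (w τ : Polynomial ℝ).eval (M.left τ) ^ 2) / 2) := by
    intro τ
    have hp := HasACDeriv.polynomial (α := M.left τ) (β := M.right τ) (w τ : Polynomial ℝ)
    have h1 := hp.integral_mul_add hp (M.left_lt_right τ).le
    have h2 : ∫ x in M.left τ..M.right τ,
        (w τ : Polynomial ℝ).derivative.eval x * (w τ : Polynomial ℝ).eval x =
        ∫ x in M.left τ..M.right τ,
        (w τ : Polynomial ℝ).eval x * (w τ : Polynomial ℝ).derivative.eval x :=
      intervalIntegral.integral_congr fun x _ => mul_comm _ _
    simp only [mul_assoc]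
    rw [intervalIntegral.integral_const_mul]
    rw [h2] at h1
    congr 1
    linarith
  have hbd : ∑ v, ((∑ e ∈ N.edgesAt v, b e * N.n e v * (c (Sum.inl v)) ^ 2)) ≤
      2 * ∑ v with N.IsOutflow b v, ∑ e ∈ N.edgesAt v,
        b e * N.n e v * c (Sum.inl v) * c (Sum.inl v) := by
    rw [Finset.sum_filter, Finset.mul_sum]
    refine Finset.sum_le_sum fun v _ => ?_
    have e1 : ∑ e ∈ N.edgesAt v, b e * N.n e v * (c (Sum.inl v)) ^ 2 =
        (∑ e ∈ N.edgesAt v, b e * N.n e v) * c (Sum.inl v) ^ 2 := by rw [Finset.sum_mul]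
    have e2 : ∑ e ∈ N.edgesAt v, b e * N.n e v * c (Sum.inl v) * c (Sum.inl v) =
        (∑ e ∈ N.edgesAt v, b e * N.n e v) * c (Sum.inl v) ^ 2 := by
      rw [← e1]
      exact Finset.sum_congr rfl fun e _ => by ring
    rw [e1, e2]
    by_cases ho : N.IsOutflow b v
    · rw [if_pos ho]
      nlinarith [mul_nonneg ho.sum_nonneg (sq_nonneg (c (Sum.inl v)))]
    · rw [if_neg ho, mul_zero]
      refine le_of_eq ?_
      by_cases hi : N.IsInner v
      · rw [hb v hi, zero_mul]
      · by_cases hf : N.IsInflow b v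
        · rw [hc v hf]; ring
        · rw [Finset.sum_eq_zero fun e he => N.eq_zero_of_not_boundary_flow hi hf ho he, zero_mul]
  have h3 := M.sum_elem_node b fun p => c p ^ 2
  have h4 := Finset.sum_le_sum fun (τ : M.Elem) (_ : τ ∈ Finset.univ) =>
    upwind_energy (b τ.1) ((w τ : Polynomial ℝ).eval (M.left τ))
      ((w τ : Polynomial ℝ).eval (M.right τ)) (c (M.nodeL τ)) (c (M.nodeR τ))
  rw [Finset.sum_add_distrib, Finset.sum_neg_distrib, ← Finset.sum_div, Finset.sum_neg_distrib,
    h3] at h4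
  unfold bilin
  simp only [hvol]
  linarith

theorem bilin_sub [Fintype V] [DecidableEq V] {k : ℕ} (b : N.E → ℝ) (p p' w : M.W k)
    (q q' c : M.GridPt → ℝ) :
    M.bilin b (p - p') (q - q') w c = M.bilin b p q w c - M.bilin b p' q' w c := by
  classical
  unfold bilin
  have h1 : ∀ τ : M.Elem, ∫ x in M.left τ..M.right τ, b τ.1 * ((p - p') τ : Polynomial ℝ).eval x *
        (w τ : Polynomial ℝ).derivative.eval x =
      (∫ x in M.left τ..M.right τ, b τ.1 * (p τ : Polynomial ℝ).eval x *
        (w τ : Polynomial ℝ).derivative.eval x) -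
      ∫ x in M.left τ..M.right τ, b τ.1 * (p' τ : Polynomial ℝ).eval x *
        (w τ : Polynomial ℝ).derivative.eval x := by
    intro τ
    rw [← intervalIntegral.integral_sub]
    · refine intervalIntegral.integral_congr fun x _ => ?_
      simp only [Pi.sub_apply, Submodule.coe_sub, Polynomial.eval_sub]
      ring
    · exact Continuous.intervalIntegrable (by fun_prop) _ _
    · exact Continuous.intervalIntegrable (by fun_prop) _ _
  simp only [h1]
  simp only [upwind, Pi.sub_apply, Submodule.coe_sub, Polynomial.eval_sub, mul_sub, sub_mul,
    add_mul, Finset.sum_sub_distrib, Finset.sum_add_distrib]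
  ring

/-- `p` is the Radau projection of `F`: on every element it has the same moments of order less than
`k` and the same value at the end point where the flow leaves the element. For `b = 0` the choice of
the end point is immaterial. -/
structure IsRadau {k : ℕ} (b : N.E → ℝ) (F : N.E → ℝ → ℝ) (p : M.W k) : Prop where
  right : ∀ τ : M.Elem, 0 ≤ b τ.1 → (p τ : Polynomial ℝ).eval (M.right τ) = F τ.1 (M.right τ)
  left : ∀ τ : M.Elem, b τ.1 < 0 → (p τ : Polynomial ℝ).eval (M.left τ) = F τ.1 (M.left τ)
  orth : ∀ (τ : M.Elem) (r : Polynomial ℝ), r.degree < k →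
    ∫ x in M.left τ..M.right τ, (F τ.1 x - (p τ : Polynomial ℝ).eval x) * r.eval x = 0

theorem exists_isRadau (k : ℕ) (b : N.E → ℝ) {F : N.E → ℝ → ℝ}
    (hF : ∀ e, ContinuousOn (F e) (Icc 0 (N.len e))) : ∃ p : M.W k, M.IsRadau b F p := by
  have h : ∀ τ : M.Elem, ∃ p : Polynomial.degreeLE ℝ (k : WithBot ℕ),
      (0 ≤ b τ.1 → (p : Polynomial ℝ).eval (M.right τ) = F τ.1 (M.right τ)) ∧
      (b τ.1 < 0 → (p : Polynomial ℝ).eval (M.left τ) = F τ.1 (M.left τ)) ∧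
      ∀ (r : Polynomial ℝ), r.degree < k →
        ∫ x in M.left τ..M.right τ, (F τ.1 x - (p : Polynomial ℝ).eval x) * r.eval x = 0 := by
    intro τ
    have hc := (hF τ.1).mono (M.Icc_subset τ)
    by_cases hb : 0 ≤ b τ.1
    · obtain ⟨p, h1, h2⟩ := exists_radau (M.left_lt_right τ) (Or.inl ⟨rfl, rfl⟩) k hc
      exact ⟨p, fun _ => h1, fun h => absurd hb (not_le.2 h), h2⟩
    · obtain ⟨p, h1, h2⟩ := exists_radau (M.left_lt_right τ) (Or.inr ⟨rfl, rfl⟩) k hc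
      exact ⟨p, fun h => absurd h hb, fun _ => h1, h2⟩
  choose p h1 h2 h3 using h
  exact ⟨p, h1, h2, h3⟩

theorem degree_derivative_lt_of_mem {k : ℕ} (w : Polynomial.degreeLE ℝ (k : WithBot ℕ)) :
    (w : Polynomial ℝ).derivative.degree < k := by
  have hw := Polynomial.mem_degreeLE.1 w.2
  rcases eq_or_ne (w : Polynomial ℝ).derivative 0 with h0 | h0
  · rw [h0, Polynomial.degree_zero]
    exact WithBot.bot_lt_coe k
  · have : (w : Polynomial ℝ) ≠ 0 := fun h => h0 (by simp [h])
    exact (Polynomial.degree_derivative_lt this).trans_le hw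

/-- Consistency of the scheme: inserting the Radau projection of `F` and the nodal values of `F` into
the bilinear form gives the integral of `b F'` against the test function. -/
theorem bilin_radau [Fintype V] [DecidableEq V] {k : ℕ} {b : N.E → ℝ}
    (hb : N.FlowConservation b) {F f : N.E → ℝ → ℝ}
    (hF : ∀ e, HasACDeriv 0 (N.len e) (F e) (f e))
    {p : M.W k} (hp : M.IsRadau b F p) {c : M.GridPt → ℝ}
    (hcL : ∀ τ : M.Elem, 0 < b τ.1 → c (M.nodeL τ) = F τ.1 (M.left τ))
    (hcR : ∀ τ : M.Elem, b τ.1 < 0 → c (M.nodeR τ) = F τ.1 (M.right τ))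
    (hmix : ∀ v, N.IsInner v ∨ N.IsOutflow b v →
      ∑ e ∈ N.edgesAt v, b e * N.n e v * F e (N.coord e v) =
        ∑ e ∈ N.edgesAt v, b e * N.n e v * c (Sum.inl v))
    (w : M.W k) (d : M.GridPt → ℝ) (hd : ∀ v, N.IsInflow b v → d (Sum.inl v) = 0) :
    M.bilin b p c w d = ∑ τ : M.Elem, ∫ x in M.left τ..M.right τ,
      b τ.1 * f τ.1 x * (w τ : Polynomial ℝ).eval x := by
  classical
  have hel : ∀ τ : M.Elem,
      -(∫ x in M.left τ..M.right τ, b τ.1 * (p τ : Polynomial ℝ).eval x *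
        (w τ : Polynomial ℝ).derivative.eval x) +
      (upwind (-b τ.1) ((p τ : Polynomial ℝ).eval (M.left τ)) (c (M.nodeL τ))
          * ((w τ : Polynomial ℝ).eval (M.left τ) - d (M.nodeL τ))
        + upwind (b τ.1) ((p τ : Polynomial ℝ).eval (M.right τ)) (c (M.nodeR τ))
          * ((w τ : Polynomial ℝ).eval (M.right τ) - d (M.nodeR τ))) =
      (∫ x in M.left τ..M.right τ, b τ.1 * f τ.1 x * (w τ : Polynomial ℝ).eval x)
        - b τ.1 * (F τ.1 (M.right τ) * d (M.nodeR τ) - F τ.1 (M.left τ) * d (M.nodeL τ)) := by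
    intro τ
    have hle := (M.left_lt_right τ).le
    have hFτ := (hF τ.1).mono (M.left_nonneg τ) hle (M.right_le_len τ)
    have h1 := hFτ.integral_mul_add (HasACDeriv.polynomial (w τ : Polynomial ℝ)) hle
    have h2 := hp.orth τ _ (degree_derivative_lt_of_mem (w τ))
    have h3 : ∫ x in M.left τ..M.right τ, (p τ : Polynomial ℝ).eval x *
        (w τ : Polynomial ℝ).derivative.eval x =
        ∫ x in M.left τ..M.right τ, F τ.1 x * (w τ : Polynomial ℝ).derivative.eval x := by
      simp only [sub_mul] at h2
      rw [intervalIntegral.integral_sub] at h2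
      · linarith
      · refine ContinuousOn.intervalIntegrable ?_
        rw [uIcc_of_le hle]
        exact (hFτ.continuousOn hle).mul (Polynomial.continuous _).continuousOn
      · exact Continuous.intervalIntegrable (by fun_prop) _ _
    -- the upwind fluxes are the exact ones
    have hfluxL : upwind (-b τ.1) ((p τ : Polynomial ℝ).eval (M.left τ)) (c (M.nodeL τ)) =
        -b τ.1 * F τ.1 (M.left τ) := by
      unfold upwind
      rcases lt_trichotomy (b τ.1) 0 with h | h | h
      · rw [hp.left τ h, max_eq_left (by linarith), min_eq_right (by linarith)]
        ring
      · simp [h]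
      · rw [hcL τ h, max_eq_right (by linarith), min_eq_left (by linarith)]
        ring
    have hfluxR : upwind (b τ.1) ((p τ : Polynomial ℝ).eval (M.right τ)) (c (M.nodeR τ)) =
        b τ.1 * F τ.1 (M.right τ) := by
      unfold upwind
      rcases lt_or_ge (b τ.1) 0 with h | h
      · rw [hcR τ h, max_eq_right h.le, min_eq_left h.le]
        ring
      · rw [hp.right τ h, max_eq_left h, min_eq_right h]
        ring
    rw [hfluxL, hfluxR]
    simp only [mul_assoc]
    rw [intervalIntegral.integral_const_mul, intervalIntegral.integral_const_mul, h3]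
    linear_combination -(b τ.1) * h1
  have hvert : ∑ τ : M.Elem,
      b τ.1 * (F τ.1 (M.right τ) * d (M.nodeR τ) - F τ.1 (M.left τ) * d (M.nodeL τ)) =
      ∑ v with N.IsOutflow b v, ∑ e ∈ N.edgesAt v,
        b e * N.n e v * c (Sum.inl v) * d (Sum.inl v) := by
    have h1 := M.sum_elem_telescope b fun e j => F e (M.pt e j) * d (M.node e j)
    simp only [M.node_zero, M.node_last, M.pt_zero, M.pt_last] at h1
    have h2 := N.sum_vertices fun e v => b e * (F e (N.coord e v) * d (Sum.inl v))
    simp only [← mul_sub, N.coord_start, N.coord_end] at h2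
    refine h1.trans (h2.symm.trans ?_)
    rw [Finset.sum_filter]
    refine Finset.sum_congr rfl fun v _ => ?_
    have e1 : ∑ e ∈ N.edgesAt v, N.n e v * (b e * (F e (N.coord e v) * d (Sum.inl v))) =
        (∑ e ∈ N.edgesAt v, b e * N.n e v * F e (N.coord e v)) * d (Sum.inl v) := by
      rw [Finset.sum_mul]
      exact Finset.sum_congr rfl fun e _ => by ring
    rw [e1, ← Finset.sum_mul]
    by_cases ho : N.IsOutflow b v
    · rw [if_pos ho, hmix v (Or.inr ho)]
    · rw [if_neg ho]
      by_cases hi : N.IsInner v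
      · rw [hmix v (Or.inl hi), ← Finset.sum_mul, hb v hi]
        ring
      · by_cases hf : N.IsInflow b v
        · rw [hd v hf, mul_zero]
        · rw [Finset.sum_eq_zero fun e he => by
            rw [N.eq_zero_of_not_boundary_flow hi hf ho he, zero_mul], zero_mul]
  have hsum := Finset.sum_congr rfl fun (τ : M.Elem) (_ : τ ∈ Finset.univ) => hel τ
  rw [Finset.sum_add_distrib, Finset.sum_neg_distrib, Finset.sum_sub_distrib, hvert] at hsum
  unfold bilin
  linarith

end Mesh

/-! ### The error of the Radau projection -/

namespace Mesh

variable {V : Type u} {N : Network V} (M : Mesh N)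

theorem brokenSeminorm_eq {n : ℕ} {f g : N.L2} (h : M.IsBrokenDeriv n f g) :
    M.brokenSeminorm n f = ‖g‖ₑ := by
  refine le_antisymm (iInf_le_of_le ⟨g, h⟩ le_rfl) (le_iInf fun g' => le_of_eq ?_)
  have : g = g'.1 := M.L2_ext fun τ => HasWeakDeriv.ae_eq
    ((Network.L2.l2On g τ.1).mono (M.left_nonneg τ) (M.right_le_len τ)).integrableOn
    ((Network.L2.l2On g'.1 τ.1).mono (M.left_nonneg τ) (M.right_le_len τ)).integrableOn
    (h τ) (g'.2 τ)
  rw [this]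

variable {M}

theorem IsRadau.sub {k : ℕ} {b : N.E → ℝ} {F F' : N.E → ℝ → ℝ} {p p' : M.W k}
    (hp : M.IsRadau b F p) (hp' : M.IsRadau b F' p')
    (hF : ∀ e, ContinuousOn (F e) (Icc 0 (N.len e)))
    (hF' : ∀ e, ContinuousOn (F' e) (Icc 0 (N.len e))) :
    M.IsRadau b (fun e x => F e x - F' e x) (p - p') where
  right τ h := by
    rw [← hp.right τ h, ← hp'.right τ h]
    simp
  left τ h := by
    rw [← hp.left τ h, ← hp'.left τ h]
    simp
  orth τ r hr := by
    have h1 := hp.orth τ r hr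
    have h2 := hp'.orth τ r hr
    have hi : ∀ (G : N.E → ℝ → ℝ) (q : M.W k), (∀ e, ContinuousOn (G e) (Icc 0 (N.len e))) →
        IntervalIntegrable (fun x => (G τ.1 x - (q τ : Polynomial ℝ).eval x) * r.eval x) volume
          (M.left τ) (M.right τ) := by
      intro G q hG
      refine ContinuousOn.intervalIntegrable ?_
      rw [uIcc_of_le (M.left_lt_right τ).le]
      exact (((hG τ.1).mono (M.Icc_subset τ)).sub (Polynomial.continuous _).continuousOn).mul
        (Polynomial.continuous _).continuousOn
    have h3 := intervalIntegral.integral_sub (hi F p hF) (hi F' p' hF')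
    rw [h1, h2, sub_zero] at h3
    rw [← h3]
    refine intervalIntegral.integral_congr fun x _ => ?_
    simp only [Pi.sub_apply, Submodule.coe_sub, Polynomial.eval_sub]
    ring

/-- The Radau projection approximates to the order `k + 1` in the mesh size. -/
theorem IsRadau.norm_sub_le {k : ℕ} {b : N.E → ℝ} {F : N.E → ℝ → ℝ} {p : M.W k}
    (hp : M.IsRadau b F p) {w : N.L2} (hF : N.IsContRep w F) (D : ℕ → N.L2)
    (hD : ∀ j ≤ k + 1, M.IsBrokenDeriv j w (D j)) :
    ‖w - M.toL2 p‖ ≤ 2 * M.h ^ (k + 1) * ‖D (k + 1)‖ := by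
  have h0 : 0 ≤ 2 * M.h ^ (k + 1) * ‖D (k + 1)‖ :=
    mul_nonneg (mul_nonneg zero_le_two (pow_nonneg M.h_nonneg _)) (norm_nonneg _)
  refine abs_le_of_sq_le_sq' ?_ h0 |>.2
  rw [mul_pow, M.norm_sq_eq_sum_elem, M.norm_sq_eq_sum_elem (D (k + 1)), Finset.mul_sum]
  refine Finset.sum_le_sum fun τ _ => ?_
  have hlt := M.left_lt_right τ
  have hL : ∀ f : N.L2, L2On (M.left τ) (M.right τ) (f τ.1) := fun f =>
    (Network.L2.l2On f τ.1).mono (M.left_nonneg τ) (M.right_le_len τ)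
  have hFac : HasACDeriv (M.left τ) (M.right τ) (F τ.1) (D 1 τ.1) :=
    HasWeakDeriv.hasACDeriv hlt ((hF τ.1).1.mono (M.Icc_subset τ)) (M.restrict_elem_ae (hF τ.1).2)
      (hL (D 1)).integrableOn (hD 1 (by omega) τ)
  obtain ⟨q, hq, hqi⟩ := exists_polynomial_approx hlt k (fun j => D (j + 1) τ.1)
    (fun j _ => hL _) fun j hj =>
      HasWeakDeriv.succ (hD (j + 1) (by omega) τ) (hD (j + 1 + 1) (by omega) τ)
  have h1 : ∫ x in M.left τ..M.right τ, (F τ.1 x - (p τ : Polynomial ℝ).eval x) ^ 2 ≤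
      4 * ((M.right τ - M.left τ) ^ 2 *
        ∫ x in M.left τ..M.right τ, (D 1 τ.1 x - q.eval x) ^ 2) := by
    have hpd := Polynomial.mem_degreeLE.1 (p τ).2
    by_cases hb : 0 ≤ b τ.1
    · exact radau_error_le hlt (Or.inl ⟨rfl, rfl⟩) k hFac (hL _) _ hpd (hp.right τ hb) (hp.orth τ)
        q hq
    · exact radau_error_le hlt (Or.inr ⟨rfl, rfl⟩) k hFac (hL _) _ hpd (hp.left τ (not_le.1 hb))
        (hp.orth τ) q hq
  have h2 : ∫ x in M.left τ..M.right τ, (w - M.toL2 p) τ.1 x ^ 2 =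
      ∫ x in M.left τ..M.right τ, (F τ.1 x - (p τ : Polynomial ℝ).eval x) ^ 2 := by
    refine M.integral_congr_elem τ ?_
    filter_upwards [M.toL2_ae p τ, M.restrict_elem_ae (hF τ.1).2,
      M.restrict_elem_ae (Lp.coeFn_sub (w τ.1) (M.toL2 p τ.1))] with x e1 e2 e3
    rw [PiLp.sub_apply, e3, Pi.sub_apply, e1, e2]
  rw [h2]
  refine h1.trans ?_
  have hd : 0 ≤ M.right τ - M.left τ := by linarith
  have h3 : (M.right τ - M.left τ) ^ (k + 1) ≤ M.h ^ (k + 1) :=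
    pow_le_pow_left₀ hd (M.length_le_h τ) _
  have hI := intervalIntegral_sq_nonneg hlt.le (D (k + 1) τ.1)
  calc 4 * ((M.right τ - M.left τ) ^ 2 *
        ∫ x in M.left τ..M.right τ, (D 1 τ.1 x - q.eval x) ^ 2)
      ≤ 4 * ((M.right τ - M.left τ) ^ 2 * (((M.right τ - M.left τ) ^ k) ^ 2 *
          ∫ x in M.left τ..M.right τ, D (k + 1) τ.1 x ^ 2)) := by
        gcongr
    _ = 4 * (((M.right τ - M.left τ) ^ (k + 1)) ^ 2 *
          ∫ x in M.left τ..M.right τ, D (k + 1) τ.1 x ^ 2) := by ring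
    _ ≤ 4 * ((M.h ^ (k + 1)) ^ 2 * ∫ x in M.left τ..M.right τ, D (k + 1) τ.1 x ^ 2) := by
        gcongr
    _ = (2 * M.h ^ (k + 1)) ^ 2 * ∫ x in M.left τ..M.right τ, D (k + 1) τ.1 x ^ 2 := by ring

/-! ### Time integrals of elementwise weak derivatives -/

variable (M) in
/-- Testing with a continuous function on one element is a continuous functional on `L²`. -/
theorem exists_testFunctional (τ : M.Elem) {ψ : ℝ → ℝ} (hψ : Continuous ψ) :
    ∃ Λ : N.L2 →L[ℝ] ℝ, ∀ f, Λ f = ∫ x in Ioo (M.left τ) (M.right τ), f τ.1 x * ψ x := by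
  have hsub := Ioo_subset_Ioo (M.left_nonneg τ) (M.right_le_len τ)
  have hm : MemLp ((Ioo (M.left τ) (M.right τ)).indicator ψ) 2 (N.vol τ.1) :=
    MemLp.indicator measurableSet_Ioo (L2On.of_continuousOn hψ.continuousOn)
  refine ⟨(innerSL ℝ (hm.toLp _)).comp (PiLp.proj 2 (fun e : N.E => Lp ℝ 2 (N.vol e)) τ.1),
    fun f => ?_⟩
  have h1 : inner ℝ (hm.toLp _) (f τ.1) =
      ∫ x in Ioo 0 (N.len τ.1), (Ioo (M.left τ) (M.right τ)).indicator
        (fun y => f τ.1 y * ψ y) x := by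
    rw [L2.inner_def]
    refine integral_congr_ae ?_
    filter_upwards [hm.coeFn_toLp] with x hx
    rw [hx]
    by_cases h : x ∈ Ioo (M.left τ) (M.right τ) <;> simp [h]
  rw [setIntegral_indicator measurableSet_Ioo, inter_eq_self_of_subset_right hsub] at h1
  exact h1

/-- Elementwise weak derivatives commute with the Bochner integral in time. -/
theorem isBrokenDeriv_integral {j : ℕ} {s t : ℝ} (hst : s ≤ t) {f g : ℝ → N.L2}
    (hf : IntervalIntegrable f volume s t) (hg : IntervalIntegrable g volume s t)
    (h : ∀ᵐ r ∂(volume.restrict (Icc s t)), M.IsBrokenDeriv j (f r) (g r)) :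
    M.IsBrokenDeriv j (∫ r in s..t, f r) (∫ r in s..t, g r) := by
  intro τ φ h1 h2 h3
  obtain ⟨Λ, hΛ⟩ := M.exists_testFunctional τ (ψ := iteratedDeriv j φ)
    (h1.continuous_iteratedDeriv j (by exact_mod_cast le_top))
  obtain ⟨Λ', hΛ'⟩ := M.exists_testFunctional τ (ψ := φ) h1.continuous
  rw [← hΛ, ← hΛ', ← Λ.intervalIntegral_comp_comm hf, ← Λ'.intervalIntegral_comp_comm hg,
    ← intervalIntegral.integral_const_mul, intervalIntegral.integral_of_le hst,
    intervalIntegral.integral_of_le hst]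
  refine integral_congr_ae ?_
  filter_upwards [ae_restrict_of_ae_restrict_of_subset Ioc_subset_Icc_self h] with r hr
  rw [hΛ, hΛ']
  exact hr τ φ h1 h2 h3

end Mesh

namespace Network

variable {V : Type u} {N : Network V}

theorem integral_timeDeriv {T : ℝ} {w : ℝ → N.L2} (hT : 0 < T)
    (hw : ContDiffOn ℝ 1 w (Icc 0 T)) {s t : ℝ} (hs : 0 ≤ s) (hst : s ≤ t) (ht : t ≤ T) :
    IntervalIntegrable (N.timeDeriv T w) volume s t ∧
      ∫ r in s..t, N.timeDeriv T w r = w t - w s := by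
  have hsub : Icc s t ⊆ Icc 0 T := Icc_subset_Icc hs ht
  have hc : ContinuousOn (N.timeDeriv T w) (Icc 0 T) :=
    hw.continuousOn_derivWithin (uniqueDiffOn_Icc hT) le_rfl
  have hi : IntervalIntegrable (N.timeDeriv T w) volume s t :=
    ContinuousOn.intervalIntegrable (by rw [uIcc_of_le hst]; exact hc.mono hsub)
  refine ⟨hi, intervalIntegral.integral_eq_sub_of_hasDerivAt_of_le hst (hw.continuousOn.mono hsub)
    (fun r hr => ?_) hi⟩
  have hr' : r ∈ Ioo 0 T := ⟨hs.trans_lt hr.1, hr.2.trans_le ht⟩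
  exact ((hw.differentiableOn (by simp)) r (Ioo_subset_Icc_self hr')).hasDerivWithinAt.hasDerivAt
    (Icc_mem_nhds hr'.1 hr'.2)

end Network

namespace Mesh

variable {V : Type u} {N : Network V} {M : Mesh N}

theorem MemLinfH.essSup_lt_top {n : ℕ} {T : ℝ} {w : ℝ → N.L2} (h : M.MemLinfH n T w) :
    essSup (fun t => M.brokenSeminorm n (w t)) (volume.restrict (Icc 0 T)) < ⊤ := by
  obtain ⟨D, hD, hw⟩ := h n le_rfl
  have h1 : (fun t => M.brokenSeminorm n (w t)) =ᵐ[volume.restrict (Icc 0 T)]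
      fun t => ‖D t‖ₑ := by
    filter_upwards [hw] with t ht using M.brokenSeminorm_eq ht
  rw [essSup_congr_ae h1]
  simpa [eLpNorm_exponent_top, eLpNormEssSup] using hD.2

theorem ae_norm_le_of_essSup_le {n : ℕ} {T : ℝ} {w D : ℝ → N.L2} {S : ℝ≥0∞} (hS : S ≠ ⊤)
    (h : essSup (fun t => M.brokenSeminorm n (w t)) (volume.restrict (Icc 0 T)) ≤ S)
    (hD : ∀ᵐ t ∂(volume.restrict (Icc 0 T)), M.IsBrokenDeriv n (w t) (D t)) :
    ∀ᵐ t ∂(volume.restrict (Icc 0 T)), ‖D t‖ ≤ S.toReal := by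
  filter_upwards [hD, ENNReal.ae_le_essSup fun t => M.brokenSeminorm n (w t)] with t h1 h2
  rw [M.brokenSeminorm_eq h1] at h2
  rw [← toReal_enorm]
  exact ENNReal.toReal_mono hS (h2.trans h)

/-- The broken derivatives of the increments `w(t) - w(s)`, whose highest one is Lipschitz in time. -/
theorem exists_brokenDeriv_increment {n : ℕ} {T : ℝ} (hT : 0 < T) {w : ℝ → N.L2}
    (hw : ContDiffOn ℝ 1 w (Icc 0 T)) (hH : M.MemLinfH n T (N.timeDeriv T w)) {S : ℝ≥0∞}
    (hS : S ≠ ⊤)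
    (hle : essSup (fun t => M.brokenSeminorm n (N.timeDeriv T w t))
      (volume.restrict (Icc 0 T)) ≤ S) {s t : ℝ} (hs : 0 ≤ s) (hst : s ≤ t) (ht : t ≤ T) :
    ∃ D : ℕ → N.L2, (∀ j ≤ n, M.IsBrokenDeriv j (w t - w s) (D j)) ∧
      ‖D n‖ ≤ S.toReal * (t - s) := by
  choose! D hD hDw using hH
  have hsub : Icc s t ⊆ Icc 0 T := Icc_subset_Icc hs ht
  obtain ⟨hi, heq⟩ := Network.integral_timeDeriv hT hw hs hst ht
  refine ⟨fun j => ∫ r in s..t, D j r, fun j hj => ?_, ?_⟩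
  · rw [← heq]
    refine isBrokenDeriv_integral hst hi ?_
      (ae_restrict_of_ae_restrict_of_subset hsub (hDw j hj))
    rw [intervalIntegrable_iff_integrableOn_Icc_of_le hst]
    exact ((hD j hj).integrable le_top).mono_measure (Measure.restrict_mono hsub le_rfl)
  · have h1 := ae_norm_le_of_essSup_le hS hle (hDw n le_rfl)
    have h2 := ae_restrict_of_ae_restrict_of_subset (Ioc_subset_Icc_self.trans hsub) h1
    have h3 := intervalIntegral.norm_integral_le_of_norm_le_const_ae (a := s) (b := t)
      (f := D n) (C := S.toReal) (by
        rw [uIoc_of_le hst]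
        exact (ae_restrict_iff' measurableSet_Ioc).1 h2)
    rwa [abs_of_nonneg (by linarith)] at h3

end Mesh

/-! ### The energy estimate -/

/-- Gronwall's lemma for absolutely continuous functions. -/
theorem HasACDeriv.gronwall {T c : ℝ} (hc : 0 ≤ c) {E E' : ℝ → ℝ}
    (hE : HasACDeriv 0 T E E') (h : ∀ᵐ t, t ∈ Ioo 0 T → E' t ≤ E t + c) {t : ℝ}
    (ht : t ∈ Icc 0 T) : E t ≤ Real.exp t * (E 0 + c * t) := by
  have h1 : HasACDeriv 0 T (fun s => Real.exp (-s)) (deriv fun s => Real.exp (-s)) :=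
    HasACDeriv.of_contDiff (by fun_prop)
  have hG := (hE.mul h1).mono le_rfl ht.1 ht.2
  have h2 := hG.integral_eq ht.1
  have h3 := intervalIntegral.integral_mono_ae_restrict ht.1 (hG.intervalIntegrable ht.1)
    (intervalIntegrable_const (c := c)) (by
      rw [← restrict_Ioo_eq_restrict_Icc]
      refine (ae_restrict_iff' measurableSet_Ioo).2 ?_
      filter_upwards [h] with s hs hst
      have hs' := hs (Ioo_subset_Ioo_right ht.2 hst)
      have hd : deriv (fun s : ℝ => Real.exp (-s)) s = -Real.exp (-s) := by
        rw [(hasDerivAt_neg s).exp.deriv, mul_neg_one]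
      rw [hd]
      have e1 : 0 < Real.exp (-s) := Real.exp_pos _
      have e2 : Real.exp (-s) ≤ 1 := Real.exp_le_one_iff.2 (by linarith [hst.1])
      nlinarith [mul_le_mul_of_nonneg_right hs' e1.le, mul_le_mul_of_nonneg_left e2 hc])
  rw [h2, intervalIntegral.integral_const, smul_eq_mul, sub_zero, neg_zero, Real.exp_zero,
    mul_one] at h3
  have h4 : E t = Real.exp t * (E t * Real.exp (-t)) := by
    rw [mul_left_comm, ← Real.exp_add, add_neg_cancel, Real.exp_zero, mul_one]
  rw [h4]
  refine mul_le_mul_of_nonneg_left ?_ (Real.exp_pos _).le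
  linarith

/-- Product rule for a bilinear form in coordinates. -/
theorem HasACDeriv.bilinForm {ι : Type*} [Fintype ι] [DecidableEq ι] {α β : ℝ}
    (B : (ι → ℝ) →ₗ[ℝ] (ι → ℝ) →ₗ[ℝ] ℝ) {γ γ' : ℝ → ι → ℝ}
    (h : ∀ i, HasACDeriv α β (fun t => γ t i) fun t => γ' t i) :
    HasACDeriv α β (fun t => B (γ t) (γ t)) fun t => B (γ' t) (γ t) + B (γ t) (γ' t) := by
  have hB : ∀ x y : ι → ℝ, B x y =
      ∑ i, ∑ j, B (Pi.single i 1) (Pi.single j 1) * (x i * y j) := by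
    intro x y
    conv_lhs => rw [pi_eq_sum_univ' x, pi_eq_sum_univ' y]
    simp only [map_sum, LinearMap.sum_apply, map_smul, LinearMap.smul_apply, smul_eq_mul,
      Finset.mul_sum]
    rw [Finset.sum_comm]
    exact Finset.sum_congr rfl fun i _ => Finset.sum_congr rfl fun j _ => by ring
  have h1 := HasACDeriv.sum Finset.univ fun i _ => HasACDeriv.sum Finset.univ fun j _ =>
    ((h i).mul (h j)).const_mul (B (Pi.single i 1) (Pi.single j 1))
  have h2 : ∀ t, B (γ' t) (γ t) + B (γ t) (γ' t) =
      ∑ i, ∑ j, B (Pi.single i 1) (Pi.single j 1) * (γ' t i * γ t j + γ t i * γ' t j) := by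
    intro t
    rw [hB (γ' t), hB (γ t), ← Finset.sum_add_distrib]
    refine Finset.sum_congr rfl fun i _ => ?_
    rw [← Finset.sum_add_distrib]
    exact Finset.sum_congr rfl fun j _ => by ring
  simp only [h2, hB (γ _) (γ _)]
  exact h1

namespace Mesh

variable {V : Type u} {N : Network V} (M : Mesh N)

/-- The coefficients of a piecewise polynomial, as a linear isomorphism. -/
noncomputable def coeffEquiv (k : ℕ) : M.W k ≃ₗ[ℝ] (M.Elem × Fin (k + 1) → ℝ) :=
  (LinearEquiv.piCongrRight fun _ : M.Elem =>
    (LinearEquiv.ofEq _ _ (Polynomial.degreeLT_succ_eq_degreeLE (R := ℝ) (n := k)).symm).trans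
      (Polynomial.degreeLTEquiv ℝ (k + 1))).trans
    (LinearEquiv.curry ℝ ℝ M.Elem (Fin (k + 1))).symm

theorem coeffEquiv_apply {k : ℕ} (w : M.W k) (i : M.Elem × Fin (k + 1)) :
    M.coeffEquiv k w i = (w i.1 : Polynomial ℝ).coeff i.2 := rfl

/-- The element of `L²` with given polynomial coefficients. -/
noncomputable def coeffToL2 (k : ℕ) : (M.Elem × Fin (k + 1) → ℝ) →ₗ[ℝ] N.L2 :=
  (M.toL2Lin k).comp (M.coeffEquiv k).symm.toLinearMap

theorem coeffToL2_coeffEquiv {k : ℕ} (w : M.W k) :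
    M.coeffToL2 k (M.coeffEquiv k w) = M.toL2 w := by
  simp [coeffToL2, toL2Lin]

theorem coeffToL2_injective (k : ℕ) : Function.Injective (M.coeffToL2 k) :=
  (M.toL2_injective (k := k)).comp (M.coeffEquiv k).symm.injective

variable {M}

/-- The coefficients of a piecewise polynomial which is Lipschitz in time are absolutely
continuous. -/
theorem hasACDeriv_coeff_of_lipschitz {k : ℕ} {T L : ℝ} (hT : 0 < T) {P : ℝ → M.W k}
    (hP : ∀ s t, 0 ≤ s → s ≤ t → t ≤ T → ‖M.toL2 (P t) - M.toL2 (P s)‖ ≤ L * (t - s))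
    (i : M.Elem × Fin (k + 1)) :
    HasACDeriv 0 T (fun t => M.coeffEquiv k (P t) i)
      (deriv fun t => M.coeffEquiv k (P t) i) := by
  obtain ⟨κ, -, hκ⟩ := (M.coeffToL2 k).exists_antilipschitzWith
    (LinearMap.ker_eq_bot.2 (M.coeffToL2_injective k))
  have hac : AbsolutelyContinuousOnInterval (fun t => M.coeffEquiv k (P t) i) 0 T := by
    refine LipschitzOnWith.absolutelyContinuousOnInterval (K := κ * L.toNNReal) ?_
    rw [uIcc_of_le hT.le]
    have key : ∀ s t, 0 ≤ s → s ≤ t → t ≤ T →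
        dist (M.coeffEquiv k (P t) i) (M.coeffEquiv k (P s) i) ≤
          ↑(κ * L.toNNReal) * dist t s := by
      intro s t hs hst ht
      have h1 := hκ.le_mul_dist (M.coeffEquiv k (P t)) (M.coeffEquiv k (P s))
      rw [coeffToL2_coeffEquiv, coeffToL2_coeffEquiv, dist_eq_norm (M.toL2 _)] at h1
      have h2 := dist_le_pi_dist (M.coeffEquiv k (P t)) (M.coeffEquiv k (P s)) i
      have h3 : L * (t - s) ≤ L.toNNReal * dist t s := by
        rw [Real.dist_eq, abs_of_nonneg (by linarith : (0 : ℝ) ≤ t - s)]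
        exact mul_le_mul_of_nonneg_right (Real.le_coe_toNNReal L) (by linarith)
      rw [NNReal.coe_mul, mul_assoc]
      exact h2.trans (h1.trans (mul_le_mul_of_nonneg_left ((hP s t hs hst ht).trans h3) κ.2))
    refine LipschitzOnWith.of_dist_le_mul fun x hx y hy => ?_
    rcases le_total y x with h | h
    · exact key y x hy.1 h hx.2
    · rw [dist_comm, dist_comm x y]
      exact key x y hx.1 h hy.2
  refine ⟨hac, ?_⟩
  filter_upwards [hac.ae_differentiableAt] with x hx hx'
  exact (hx (by rw [uIcc_of_le hT.le]; exact Ioo_subset_Icc_self hx')).hasDerivAt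

/-- The energy estimate. The discrete error `P - uh` is controlled by its initial value and by the
Lipschitz constant in time of the projection error `u - P`, if the weighted inner product of
`∂ₜ(u - uh)` with the discrete error is nonpositive. -/
theorem energy_estimate {a₀ A : ℝ} {a : N.E → ℝ → ℝ} (ha : N.IsWeight a₀ A a) (hA : 0 ≤ A) {k : ℕ}
    {T K : ℝ} (hT : 0 < T) (hK : 0 ≤ K) {u : ℝ → N.L2} (hu : ContDiffOn ℝ 1 u (Icc 0 T))
    {P uh uh' : ℝ → M.W k}
    (huh : ∀ i, HasACDeriv 0 T (fun t => M.coeffEquiv k (uh t) i)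
      fun t => M.coeffEquiv k (uh' t) i)
    (hη : ∀ s t, 0 ≤ s → s ≤ t → t ≤ T →
      ‖(u t - M.toL2 (P t)) - (u s - M.toL2 (P s))‖ ≤ K * (t - s))
    (hdiss : ∀ᵐ t, t ∈ Ioo 0 T →
      Network.aForm ha (N.timeDeriv T u t - M.toL2 (uh' t)) (M.toL2 (P t - uh t)) ≤ 0)
    {t : ℝ} (ht : t ∈ Icc 0 T) :
    Network.aForm ha (M.toL2 (P t - uh t)) (M.toL2 (P t - uh t)) ≤
      Real.exp t * (Network.aForm ha (M.toL2 (P 0 - uh 0)) (M.toL2 (P 0 - uh 0)) +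
        A * K ^ 2 * t) := by
  classical
  obtain ⟨U, hU⟩ := isCompact_Icc.exists_bound_of_continuousOn
    (hu.continuousOn_derivWithin (uniqueDiffOn_Icc hT) le_rfl)
  have hPlip : ∀ s t, 0 ≤ s → s ≤ t → t ≤ T →
      ‖M.toL2 (P t) - M.toL2 (P s)‖ ≤ (U + K) * (t - s) := by
    intro s t hs hst ht
    have h1 : ‖u t - u s‖ ≤ U * (t - s) := by
      rw [← (Network.integral_timeDeriv hT hu hs hst ht).2]
      have := intervalIntegral.norm_integral_le_of_norm_le_const (a := s) (b := t) (C := U)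
        (f := N.timeDeriv T u) fun r hr => by
          rw [uIoc_of_le hst] at hr
          exact hU r ⟨hs.trans hr.1.le, hr.2.trans ht⟩
      rwa [abs_of_nonneg (by linarith)] at this
    have h2 : M.toL2 (P t) - M.toL2 (P s) =
        (u t - u s) - ((u t - M.toL2 (P t)) - (u s - M.toL2 (P s))) := by abel
    rw [h2]
    refine (norm_sub_le _ _).trans ?_
    linarith [hη s t hs hst ht]
  have hPc := hasACDeriv_coeff_of_lipschitz hT hPlip
  let Φ := M.coeffToL2 k
  let π' : ℝ → M.Elem × Fin (k + 1) → ℝ := fun t i => deriv (fun t => M.coeffEquiv k (P t) i) t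
  let γ : ℝ → M.Elem × Fin (k + 1) → ℝ := fun t => M.coeffEquiv k (P t - uh t)
  let γ' : ℝ → M.Elem × Fin (k + 1) → ℝ := fun t => π' t - M.coeffEquiv k (uh' t)
  have hγ : ∀ i, HasACDeriv 0 T (fun t => γ t i) fun t => γ' t i := by
    intro i
    have := (hPc i).sub (huh i)
    simpa only [γ, γ', π', map_sub, Pi.sub_apply] using this
  have hE := HasACDeriv.bilinForm ((Network.aForm ha).compl₁₂ Φ Φ) hγ
  simp only [LinearMap.compl₁₂_apply] at hE
  have hΦγ : ∀ t, Φ (γ t) = M.toL2 (P t - uh t) := fun t => M.coeffToL2_coeffEquiv _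
  simp only [hΦγ] at hE
  refine hE.gronwall (mul_nonneg hA (sq_nonneg K)) ?_ ht
  filter_upwards [hdiss, ae_all_iff.2 fun i => (hPc i).2] with s h1 h2 hs
  have hsI : Icc 0 T ∈ nhds s := Icc_mem_nhds hs.1 hs.2
  -- the time derivative of the projection error
  have hd1 : HasDerivAt (fun r => M.toL2 (P r)) (Φ (π' s)) s := by
    have h3 : HasDerivAt (fun r => M.coeffEquiv k (P r)) (π' s) s :=
      hasDerivAt_pi.2 fun i => h2 i hs
    have h4 := (LinearMap.toContinuousLinearMap Φ).hasFDerivAt.comp_hasDerivAt s h3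
    simpa [Function.comp_def, Φ, coeffToL2_coeffEquiv] using h4
  have hd2 : HasDerivAt u (N.timeDeriv T u s) s :=
    ((hu.differentiableOn (by simp)) s (Ioo_subset_Icc_self hs)).hasDerivWithinAt.hasDerivAt hsI
  have hη' : ‖N.timeDeriv T u s - Φ (π' s)‖ ≤ K := by
    have hlip : LipschitzOnWith K.toNNReal (fun r => u r - M.toL2 (P r)) (Icc 0 T) := by
      have key : ∀ r r', 0 ≤ r → r ≤ r' → r' ≤ T →
          dist (u r' - M.toL2 (P r')) (u r - M.toL2 (P r)) ≤ K.toNNReal * dist r' r := by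
        intro r r' h3 h4 h5
        rw [dist_eq_norm, Real.dist_eq, abs_of_nonneg (by linarith : (0 : ℝ) ≤ r' - r),
          Real.coe_toNNReal K hK]
        exact hη r r' h3 h4 h5
      refine LipschitzOnWith.of_dist_le_mul fun x hx y hy => ?_
      rcases le_total y x with h | h
      · exact key y x hy.1 h hx.2
      · rw [dist_comm, dist_comm x y]
        exact key x y hx.1 h hy.2
    have := (hd2.sub hd1).le_of_lipschitzOn hsI hlip
    rwa [Real.coe_toNNReal K hK] at this
  set η' := N.timeDeriv T u s - Φ (π' s) with hη'_def
  have hsplit : Φ (γ' s) = (N.timeDeriv T u s - M.toL2 (uh' s)) + -η' := by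
    rw [hη'_def]
    simp only [γ', map_sub, Φ, coeffToL2_coeffEquiv]
    abel
  have h3 := Network.aForm_symm ha (M.toL2 (P s - uh s)) (Φ (γ' s))
  have h4 := Network.two_mul_aForm_le ha (-η') (M.toL2 (P s - uh s))
  have h5 := Network.aForm_le ha (-η')
  rw [norm_neg] at h5
  have h6 : A * ‖η'‖ ^ 2 ≤ A * K ^ 2 :=
    mul_le_mul_of_nonneg_left (pow_le_pow_left₀ (norm_nonneg _) hη' 2) hA
  have h7 := h1 hs
  rw [h3, hsplit, map_add, LinearMap.add_apply]
  linarith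

end Mesh

/-! ### The error equation and the error estimate -/

namespace Mesh

variable {V : Type u} {N : Network V} (M : Mesh N)

/-- The hybrid variable of the exact solution: the vertex values, and the values of `F` at the grid
points in the interior of the edges. -/
def nodalValues (F : N.E → ℝ → ℝ) (c : V → ℝ) : M.GridPt → ℝ :=
  Sum.elim c fun p => F p.1.1 (M.pt p.1.1 p.1.2)

theorem nodalValues_node {F : N.E → ℝ → ℝ} {c : V → ℝ} {e : N.E} {j : Fin (M.num e + 1)}
    (h0 : j = 0 → F e 0 = c e.1.1) (h1 : j = Fin.last _ → F e (N.len e) = c e.1.2) :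
    M.nodalValues F c (M.node e j) = F e (M.pt e j) := by
  unfold node
  split_ifs with h h'
  · rw [h, M.pt_zero, h0 h]
    rfl
  · rw [h', M.pt_last, h1 h']
    rfl
  · rfl

variable {M}

theorem aForm_toL2_toL2 {a₀ A : ℝ} {a : N.E → ℝ → ℝ} (ha : N.IsWeight a₀ A a) {k : ℕ}
    (w w' : M.W k) : Network.aForm ha (M.toL2 w) (M.toL2 w') =
      ∑ τ : M.Elem, ∫ x in M.left τ..M.right τ,
        a τ.1 x * (w τ : Polynomial ℝ).eval x * (w' τ : Polynomial ℝ).eval x := by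
  rw [M.aForm_toL2]
  refine Finset.sum_congr rfl fun τ _ => M.integral_congr_elem τ ?_
  filter_upwards [M.toL2_ae w τ] with x hx
  rw [hx]

/-- The error equation, tested with the discrete error: by consistency of the projections and
stability of the bilinear form, the time derivative of `u - uh` has nonpositive weighted inner
product with the discrete error. -/
theorem aForm_error_nonpos [Fintype V] [DecidableEq V] {a₀ A : ℝ} {a : N.E → ℝ → ℝ}
    (ha : N.IsWeight a₀ A a) {k : ℕ} {b : N.E → ℝ} (hb : N.FlowConservation b)
    {u ut ux : N.L2} {F : N.E → ℝ → ℝ} (hF : N.IsContRep u F) (hux : N.IsEdgeDeriv u ux)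
    (heq : ∀ e, ∀ᵐ x ∂(N.vol e), a e x * ut e x + b e * ux e x = 0) {c : V → ℝ}
    (hout : ∀ v, ∀ e ∈ N.outEdges b v, F e (N.coord e v) = c v)
    (hin : ∀ v, N.IsInner v ∨ N.IsOutflow b v →
      ∑ e ∈ N.inEdges b v, b e * N.n e v * c v =
        ∑ e ∈ N.inEdges b v, b e * N.n e v * F e (N.coord e v))
    {p uh uh' : M.W k} (hp : M.IsRadau b F p) {q : M.GridPt → ℝ}
    (hq : ∀ v, N.IsInflow b v → c v = q (Sum.inl v))
    (hscheme : ∀ (w : M.W k) (what : M.GridPt → ℝ),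
      (∀ v, N.IsInflow b v → what (Sum.inl v) = 0) →
      (∑ τ : M.Elem, ∫ x in M.left τ..M.right τ,
          a τ.1 x * (uh' τ : Polynomial ℝ).eval x * (w τ : Polynomial ℝ).eval x)
        + M.bilin b uh q w what = 0) :
    Network.aForm ha (ut - M.toL2 uh') (M.toL2 (p - uh)) ≤ 0 := by
  set w := p - uh with hw
  set d : M.GridPt → ℝ := M.nodalValues F c - q with hd
  have hd0 : ∀ v, N.IsInflow b v → d (Sum.inl v) = 0 := fun v hv => sub_eq_zero.2 (hq v hv)
  have hFac : ∀ e, HasACDeriv 0 (N.len e) (F e) (ux e) := fun e =>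
    HasWeakDeriv.hasACDeriv (N.len_pos e) (hF e).1 (hF e).2 (Network.L2.l2On ux e).integrableOn
      (hux e)
  have hcons := M.bilin_radau hb hFac hp (c := M.nodalValues F c)
    (fun τ hτ => M.nodalValues_node
      (fun _ => by
        have := hout τ.1.1.1 τ.1 (by simp [Network.outEdges, N.n_start, hτ])
        rwa [N.coord_start] at this)
      (fun h => absurd h (Fin.castSucc_lt_last τ.2).ne))
    (fun τ hτ => M.nodalValues_node
      (fun h => absurd h (Fin.succ_ne_zero τ.2))
      (fun _ => by
        have := hout τ.1.1.2 τ.1 (by simp [Network.outEdges, N.n_end, hτ])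
        rwa [N.coord_end] at this))
    (fun v hv => Network.sum_flux_eq (F := fun e => F e (N.coord e v)) (hout v) (hin v hv)) w d hd0
  have h1 := hscheme w d hd0
  rw [← aForm_toL2_toL2 ha] at h1
  have h2 : ∑ τ : M.Elem, ∫ x in M.left τ..M.right τ,
      b τ.1 * ux τ.1 x * (w τ : Polynomial ℝ).eval x = -Network.aForm ha ut (M.toL2 w) := by
    rw [M.aForm_toL2, ← Finset.sum_neg_distrib]
    refine Finset.sum_congr rfl fun τ _ => ?_
    rw [← intervalIntegral.integral_neg]
    refine M.integral_congr_elem τ ?_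
    filter_upwards [M.restrict_elem_ae (heq τ.1)] with x hx
    linear_combination ((w τ : Polynomial ℝ).eval x) * hx
  have h3 := M.bilin_self_nonneg hb w d hd0
  have h4 := M.bilin_sub b p uh w (M.nodalValues F c) q d
  rw [← hw, ← hd] at h4
  rw [map_sub, LinearMap.sub_apply]
  linarith

/-- The initial discrete error is bounded by the initial projection error, since the initial value of
the scheme is the orthogonal projection. -/
theorem norm_initial_le {k : ℕ} {u : N.L2} {p uh : M.W k}
    (h : ∀ w : M.W k, ∑ τ : M.Elem, ∫ x in M.left τ..M.right τ,
        (uh τ : Polynomial ℝ).eval x * (w τ : Polynomial ℝ).eval x =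
      ∑ τ : M.Elem, ∫ x in M.left τ..M.right τ, u τ.1 x * (w τ : Polynomial ℝ).eval x) :
    ‖M.toL2 (p - uh)‖ ≤ ‖u - M.toL2 p‖ := by
  set w := p - uh with hw
  have h1 : inner ℝ (u - M.toL2 uh) (M.toL2 w) = 0 := by
    rw [inner_sub_left, M.inner_toL2, M.inner_toL2, ← h w, sub_eq_zero]
    refine Finset.sum_congr rfl fun τ _ => M.integral_congr_elem τ ?_
    filter_upwards [M.toL2_ae uh τ] with x hx
    rw [hx]
  have h2 : M.toL2 w = (u - M.toL2 uh) - (u - M.toL2 p) := by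
    rw [hw, M.toL2_sub]
    abel
  have h3 : ‖M.toL2 w‖ ^ 2 = -inner ℝ (u - M.toL2 p) (M.toL2 w) := by
    rw [← real_inner_self_eq_norm_sq]
    nth_rewrite 1 [h2]
    rw [inner_sub_left, h1, zero_sub]
  have h4 := abs_le.1 (abs_real_inner_le_norm (u - M.toL2 p) (M.toL2 w))
  by_contra hc
  push Not at hc
  nlinarith [norm_nonneg (M.toL2 w), norm_nonneg (u - M.toL2 p), h4.1]

/-- The error of the Radau projection is Lipschitz continuous in time, of optimal order in the mesh
size. -/
theorem norm_projection_error_sub_le {T : ℝ} (hT : 0 < T) {b : N.E → ℝ} {u : ℝ → N.L2} {k : ℕ}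
    (hu : ContDiffOn ℝ 1 u (Icc 0 T)) (hreg : M.MemLinfH (k + 1) T (N.timeDeriv T u)) {S : ℝ≥0∞}
    (hS : S ≠ ⊤) (hle : essSup (fun t => M.brokenSeminorm (k + 1) (N.timeDeriv T u t))
      (volume.restrict (Icc 0 T)) ≤ S)
    {F : ℝ → N.E → ℝ → ℝ} (hF : ∀ t ∈ Icc 0 T, N.IsContRep (u t) (F t)) {P : ℝ → M.W k}
    (hP : ∀ t ∈ Icc 0 T, M.IsRadau b (F t) (P t)) (s t : ℝ) (hs : 0 ≤ s) (hst : s ≤ t)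
    (ht : t ≤ T) :
    ‖(u t - M.toL2 (P t)) - (u s - M.toL2 (P s))‖ ≤
      2 * M.h ^ (k + 1) * S.toReal * (t - s) := by
  have hsT : s ∈ Icc 0 T := ⟨hs, hst.trans ht⟩
  have htT : t ∈ Icc 0 T := ⟨hs.trans hst, ht⟩
  obtain ⟨D, hD, hDn⟩ := exists_brokenDeriv_increment hT hu hreg hS hle hs hst ht
  have hrep : N.IsContRep (u t - u s) fun e x => F t e x - F s e x := by
    refine fun e => ⟨(hF t htT e).1.sub (hF s hsT e).1, ?_⟩
    filter_upwards [(hF t htT e).2, (hF s hsT e).2, Lp.coeFn_sub (u t e) (u s e)]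
      with x h1 h2 h3
    rw [PiLp.sub_apply, h3, Pi.sub_apply, h1, h2]
  have h1 := ((hP t htT).sub (hP s hsT) (fun e => (hF t htT e).1)
    fun e => (hF s hsT e).1).norm_sub_le hrep D hD
  rw [M.toL2_sub] at h1
  rw [sub_sub_sub_comm, mul_assoc _ S.toReal]
  exact h1.trans (mul_le_mul_of_nonneg_left hDn
    (mul_nonneg zero_le_two (pow_nonneg M.h_nonneg _)))

theorem exists_norm_projection_error_le {T : ℝ} (hT : 0 < T) {b : N.E → ℝ} {u : ℝ → N.L2} {k : ℕ}
    (hreg : M.MemLinfH (k + 1) T u) {S : ℝ≥0∞} (hS : S ≠ ⊤)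
    (hle : essSup (fun t => M.brokenSeminorm (k + 1) (u t)) (volume.restrict (Icc 0 T)) ≤ S)
    {F : ℝ → N.E → ℝ → ℝ} (hF : ∀ t ∈ Icc 0 T, N.IsContRep (u t) (F t)) {P : ℝ → M.W k}
    (hP : ∀ t ∈ Icc 0 T, M.IsRadau b (F t) (P t)) :
    ∃ s ∈ Icc 0 T, ‖u s - M.toL2 (P s)‖ ≤ 2 * M.h ^ (k + 1) * S.toReal := by
  choose! D hD hDu using hreg
  have h1 : ∀ᵐ s ∂(volume.restrict (Icc 0 T)), ∀ j ≤ k + 1, M.IsBrokenDeriv j (u s) (D j s) :=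
    ae_all_iff.2 fun j => by
      by_cases hj : j ≤ k + 1
      · filter_upwards [hDu j hj] with s hs _ using hs
      · exact .of_forall fun s h => absurd h hj
  have h2 := ae_norm_le_of_essSup_le hS hle (hDu (k + 1) le_rfl)
  have : (ae (volume.restrict (Icc 0 T))).NeBot := by
    rw [ae_restrict_neBot, Real.volume_Icc]
    simpa using hT
  obtain ⟨s, h3, h4, h5⟩ := (h1.and (h2.and (ae_restrict_mem measurableSet_Icc))).exists
  refine ⟨s, h5, ((hP s h5).norm_sub_le (hF s h5) (fun j => D j s) h3).trans ?_⟩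
  exact mul_le_mul_of_nonneg_left h4 (mul_nonneg zero_le_two (pow_nonneg M.h_nonneg _))

/-- A Lipschitz function on `[0, T]` which is small at one time is small at every time. -/
theorem norm_le_of_lipschitz {X : Type*} [NormedAddCommGroup X] {T K : ℝ} (hK : 0 ≤ K) {η : ℝ → X}
    (hη : ∀ s t, 0 ≤ s → s ≤ t → t ≤ T → ‖η t - η s‖ ≤ K * (t - s))
    (h : ∃ s ∈ Icc 0 T, ‖η s‖ ≤ K) {t : ℝ} (ht : t ∈ Icc 0 T) : ‖η t‖ ≤ K * (1 + T) := by
  obtain ⟨s, hs, hsK⟩ := h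
  have h1 : ‖η t - η s‖ ≤ K * T := by
    rcases le_total s t with h | h
    · exact (hη s t hs.1 h ht.2).trans (mul_le_mul_of_nonneg_left (by linarith [hs.1, ht.2]) hK)
    · rw [norm_sub_rev]
      exact (hη t s ht.1 h hs.2).trans (mul_le_mul_of_nonneg_left (by linarith [hs.2, ht.1]) hK)
  have h2 := norm_add_le (η t - η s) (η s)
  rw [sub_add_cancel] at h2
  linarith

theorem norm_le_of_energy {a₀ A : ℝ} {a : N.E → ℝ → ℝ} (ha : N.IsWeight a₀ A a) (hA : 0 ≤ A)
    {T K t : ℝ} (hK : 0 ≤ K) (ht : t ∈ Icc 0 T) {f f₀ : N.L2} (h0 : ‖f₀‖ ≤ K * (1 + T))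
    (h : Network.aForm ha f f ≤ Real.exp t * (Network.aForm ha f₀ f₀ + A * K ^ 2 * t)) :
    ‖f‖ ≤ K * Real.sqrt (Real.exp T * (A * (1 + T) ^ 2 + A * T) / a₀) := by
  have hT : 0 ≤ T := ht.1.trans ht.2
  have hR : 0 ≤ Real.exp T * (A * (1 + T) ^ 2 + A * T) / a₀ := by
    have := ha.pos
    positivity
  refine abs_le_of_sq_le_sq' ?_ (mul_nonneg hK (Real.sqrt_nonneg _)) |>.2
  rw [mul_pow, Real.sq_sqrt hR, mul_div_assoc', le_div_iff₀ ha.pos]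
  have h1 := Network.le_aForm ha f
  have h2 := Network.aForm_le ha f₀
  have h3 : A * ‖f₀‖ ^ 2 ≤ A * (K * (1 + T)) ^ 2 :=
    mul_le_mul_of_nonneg_left (pow_le_pow_left₀ (norm_nonneg _) h0 2) hA
  have h4 : A * K ^ 2 * t ≤ A * K ^ 2 * T := mul_le_mul_of_nonneg_left ht.2 (by positivity)
  have h5 : Real.exp t ≤ Real.exp T := Real.exp_le_exp.2 ht.2
  calc ‖f‖ ^ 2 * a₀
      ≤ Real.exp t * (Network.aForm ha f₀ f₀ + A * K ^ 2 * t) := by linarith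
    _ ≤ Real.exp t * (A * (K * (1 + T)) ^ 2 + A * K ^ 2 * T) :=
        mul_le_mul_of_nonneg_left (by linarith) (Real.exp_pos _).le
    _ ≤ Real.exp T * (A * (K * (1 + T)) ^ 2 + A * K ^ 2 * T) :=
        mul_le_mul_of_nonneg_right h5 (by positivity)
    _ = K ^ 2 * (Real.exp T * (A * (1 + T) ^ 2 + A * T)) := by ring

/-- The error bound at every time. -/
theorem norm_error_le [Fintype V] [DecidableEq V] {T a₀ A : ℝ} (hT : 0 < T) (hA : 0 ≤ A)
    {a : N.E → ℝ → ℝ} (ha : N.IsWeight a₀ A a) {b : N.E → ℝ} {u₀ : N.L2} {g : V → ℝ → ℝ}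
    {u : ℝ → N.L2} {uhat : ℝ → V → ℝ} {k : ℕ} {uh : ℝ → M.W k} {uhhat : ℝ → M.GridPt → ℝ}
    (hb : N.FlowConservation b) (hsol : N.IsSolution T a b u₀ g u uhat)
    (hreg : M.MemW1infH (k + 1) T u) (hh : M.IsHDGSolution T a b u₀ g uh uhhat) {t : ℝ}
    (ht : t ∈ Icc 0 T) :
    ‖u t - M.toL2 (uh t)‖ ≤
      2 * (1 + T + Real.sqrt (Real.exp T * (A * (1 + T) ^ 2 + A * T) / a₀)) * M.h ^ (k + 1) *
        (M.w1infSeminorm (k + 1) T u).toReal := by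
  have hS : M.w1infSeminorm (k + 1) T u ≠ ⊤ :=
    (max_lt hreg.1.essSup_lt_top hreg.2.essSup_lt_top).ne
  have hu := hsol.contDiffOn
  obtain ⟨ux, -, huxd, hueq⟩ := hsol.transport
  choose! F hF hFout hFin using hsol.coupling
  have hex : ∀ t ∈ Icc 0 T, ∃ p : M.W k, M.IsRadau b (F t) p := fun t ht =>
    M.exists_isRadau k b fun e => (hF t ht e).1
  choose! P hP using hex
  obtain ⟨uh', huh', hscheme⟩ := hh.equation
  have hη := norm_projection_error_sub_le hT hu hreg.2 hS (le_max_right _ _) hF hP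
  have hηs := exists_norm_projection_error_le hT hreg.1 hS (le_max_left _ _) hF hP
  have hK : 0 ≤ 2 * M.h ^ (k + 1) * (M.w1infSeminorm (k + 1) T u).toReal :=
    mul_nonneg (mul_nonneg zero_le_two (pow_nonneg M.h_nonneg _)) ENNReal.toReal_nonneg
  generalize (M.w1infSeminorm (k + 1) T u).toReal = S at *
  have hηt := fun {t} => norm_le_of_lipschitz (η := fun t => u t - M.toL2 (P t)) hK hη hηs (t := t)
  have hdiss : ∀ᵐ t, t ∈ Ioo 0 T →
      Network.aForm ha (N.timeDeriv T u t - M.toL2 (uh' t)) (M.toL2 (P t - uh t)) ≤ 0 := by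
    filter_upwards [(ae_restrict_iff' measurableSet_Icc).1 hscheme] with t hsch ht
    have htI := Ioo_subset_Icc_self ht
    exact aForm_error_nonpos ha hb (hF t htI) (huxd t htI) (hueq t ⟨ht.1, ht.2.le⟩)
      (hFout t htI) (hFin t htI) (hP t htI)
      (fun v hv => (hsol.inflow t htI v hv).trans (hh.inflow t htI v hv).symm) (hsch htI)
  have hco : ∀ i : M.Elem × Fin (k + 1), HasACDeriv 0 T (fun t => M.coeffEquiv k (uh t) i)
      fun t => M.coeffEquiv k (uh' t) i := by
    intro i
    simp only [coeffEquiv_apply]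
    exact (huh' i.1 i.2).hasACDeriv hT
  have henergy := energy_estimate ha hA hT hK hu hco hη hdiss ht
  have hinit : ‖u 0 - M.toL2 (P 0)‖ ≤ 2 * M.h ^ (k + 1) * S * (1 + T) :=
    hηt (left_mem_Icc.2 hT.le)
  have hdisc := norm_le_of_energy ha hA hK ht ((norm_initial_le fun w => by
    rw [hsol.initial]
    exact hh.initial w).trans hinit) henergy
  have h6 : u t - M.toL2 (uh t) = (u t - M.toL2 (P t)) + M.toL2 (P t - uh t) := by
    rw [M.toL2_sub]
    abel
  rw [h6]
  refine (norm_add_le _ _).trans ((add_le_add (hηt ht) hdisc).trans_eq ?_)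
  ring

end Mesh

end HDG

theorem theorem2 :
    ∀ T a₀ a₁ : ℝ, 0 < T → 0 < a₀ → ∃ C : ℝ,
      ∀ (V : Type u) [Fintype V] [DecidableEq V] (N : HDG.Network V)
        (a : N.E → ℝ → ℝ) (b : N.E → ℝ) (u₀ : N.L2) (g : V → ℝ → ℝ)
        (u : ℝ → N.L2) (uhat : ℝ → V → ℝ)
        (M : HDG.Mesh N) (k : ℕ) (uh : ℝ → M.W k) (uhhat : ℝ → M.GridPt → ℝ),
        (∀ e, HDG.MemH 1 0 (N.len e) (a e)) →
        (∀ e, ∀ᵐ x ∂(N.vol e), a₀ ≤ a e x ∧ a e x ≤ a₁) →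
        N.FlowConservation b →
        N.IsSolution T a b u₀ g u uhat →
        M.MemW1infH (k + 1) T u →
        M.IsHDGSolution T a b u₀ g uh uhhat →
        eLpNorm (fun t => u t - M.toL2 (uh t)) ∞ (volume.restrict (Icc 0 T)) ≤
          ENNReal.ofReal (C * M.h ^ (k + 1)) * M.w1infSeminorm (k + 1) T u := by
  intro T a₀ a₁ hT ha₀
  refine ⟨2 * (1 + T + Real.sqrt (Real.exp T * (|a₁| * (1 + T) ^ 2 + |a₁| * T) / a₀)), ?_⟩
  intro V _ _ N a b u₀ g u uhat M k uh uhhat ha hab hb hsol hreg hh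
  have hw : N.IsWeight a₀ |a₁| a := by
    refine ⟨ha₀, fun e => (ha e).1.1, fun e => ?_⟩
    filter_upwards [hab e] with x hx using ⟨hx.1, hx.2.trans (le_abs_self a₁)⟩
  have hS : M.w1infSeminorm (k + 1) T u ≠ ⊤ :=
    (max_lt hreg.1.essSup_lt_top hreg.2.essSup_lt_top).ne
  rw [eLpNorm_exponent_top]
  refine ((eLpNormEssSup_le_of_ae_bound ?_).trans_eq
    (ENNReal.ofReal_mul' ENNReal.toReal_nonneg)).trans_eq (congrArg _ (ENNReal.ofReal_toReal hS))
  filter_upwards [ae_restrict_mem measurableSet_Icc] with t ht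
  exact HDG.Mesh.norm_error_le hT (abs_nonneg a₁) hw hb hsol hreg hh ht
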